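/- All graphs are finite, simple and undirected. A graph $G$ is \emph{series-parallel with terminals $s,t$} if it is the single vertex $s=t$; or the edge $st$; or $G=G_1\cup G_2$ with $G_1,G_2$ series-parallel with terminals $s,r$ and $r,t$, respectively, and $G_1\cap G_2=\{r\}$; or $G=G_1\cup G_2$ with $G_1,G_2$ both series-parallel with terminals $s,t$ and $V(G_1\cap G_2)=\{s,t\}$. An \emph{ear decomposition} of a graph with terminals $s,t$ is a sequence $E_1,\dots,E_n$ of non-trivial paths (\emph{ears}) whose union is the graph, such that $E_1$ has endvertices $s,t$ and each $E_j$ with $j\ge 2$ meets $E_1\cup\dots\cup E_{j-1}$ exactly in its endvertices. $E_j$ is \emph{nested} in $E_i$, $i<j$, if $E_i$ is the first ear that contains both endvertices of $E_j$; its \emph{nest interval} $I(E_j)$ is then the subpath of $E_i$ between these endvertices. The decomposition is \emph{nested} (a \emph{NED}) if every $E_j$ with $j\ge2$ is nested in some $E_i$, and any two ears nested in the same ear have nest intervals that are edge-disjoint or one of which contains the other. Let $G$ be a graph with a vertex $x$, let $X=N(x)\cup\{x\}$, and suppose that every vertex of $N(x)$ has degree $2$ in $G$, that $G-X$ is $2$-connected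 and series-parallel with some terminals, and that $G$ contains a $K_4$-subdivision. For $H\subseteq G$ such that $H-X$ is series-parallel with terminals $s,t$, a \emph{NED of $H$} is a NED of $H-X$ with terminals $s,t$. An ear $F$ is an \emph{$x$-ear} if some interior vertex of $F$ lies in $N(X)$ (the set of vertices of $G$ outside $X$ with a neighbour in $X$), and $\overline F$ denotes the union of $F$ with all paths of length $2$ in $G$ from interior vertices of $F$ to $x$. A NED $E_1,\dots,E_n$ of $H$ is \emph{good} if it has the maximum number of $x$-ears among all NEDs of $H$ and, subject to this, the binary number $b_1\dots b_n$, where $b_i=1$ if $E_i$ is an $x$-ear and $b_i=0$ otherwise, is maximal. The \emph{$x$-ear number} of $H$ is the number of $x$-ears in a good NED of $H$ (and $0$ if $H-X$ is a single vertex). \textbf{Lemma.} (a) If, for some terminals $s,t$ with which $G-X$ is series-parallel, the $x$-ear number of $G$ is at least $200k$, then $G$ contains $k$ edge-disjoint $K_4$-subdivisions. (b) More generally, let $H\subseteq G$ contain a $K_4$-subdivision, let $H-X$ be series-parallel with terminals $s,t$, and let $\mathcal E$ be a good NED of $H$ with $\lambda$ $x$-ears. Then $H\cup\bigcup_{F\in\mathcal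 E}\overline F$ contains $\lfloor\lambda/200\rfloor+1$ edge-disjoint $K_4$-subdivisions. If, moreover, $\lambda\ge 200$ or $\bigcup_{F\in\mathcal E}\overline F$ contains a $K_4$-subdivision, then already $\bigcup_{F\in\mathcal E}\overline F$ contains $\lfloor\lambda/200\rfloor+1$ edge-disjoint $K_4$-subdivisions. -/

import Mathlib

namespace NestedEar

variable {V : Type*} {G : SimpleGraph V}

/-- `IsSeriesParallel H s t`: the subgraph `H` is series-parallel with terminals `s, t`.
(The common vertex in a series decomposition excludes common edges.) -/
inductive IsSeriesParallel : G.Subgraph → V → V → Prop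
  | vertex (s : V) : IsSeriesParallel (G.singletonSubgraph s) s s
  | edge {s t : V} (h : G.Adj s t) : IsSeriesParallel (G.subgraphOfAdj h) s t
  | series {G₁ G₂ : G.Subgraph} {s r t : V} (h₁ : IsSeriesParallel G₁ s r)
      (h₂ : IsSeriesParallel G₂ r t) (h : G₁.verts ∩ G₂.verts = {r}) :
      IsSeriesParallel (G₁ ⊔ G₂) s t
  | parallel {G₁ G₂ : G.Subgraph} {s t : V} (h₁ : IsSeriesParallel G₁ s t)
      (h₂ : IsSeriesParallel G₂ s t) (h : G₁.verts ∩ G₂.verts = {s, t}) :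
      IsSeriesParallel (G₁ ⊔ G₂) s t

/-- 2-connected: more than two vertices, connected, and still connected
after the deletion of any one vertex. -/
def IsTwoConnected (H : G.Subgraph) : Prop :=
  2 < H.verts.encard ∧ H.Connected ∧ ∀ v ∈ H.verts, (H.deleteVerts {v}).Connected

/-- `K` is a subdivision of `K₄`: it is the union of six paths, one between any two of four
distinct branch vertices, such that two different ones of these paths meet only in common
endvertices.  (Only the paths `P i j` with `i < j` are used.) -/
def IsK4Subdivision (K : G.Subgraph) : Prop :=
  ∃ (b : Fin 4 → V) (P : ∀ i j : Fin 4, G.Walk (b i) (b j)),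
    Function.Injective b ∧
    (∀ i j, i < j → (P i j).IsPath) ∧
    (∀ i j i' j', i < j → i' < j' → (i, j) ≠ (i', j') →
      ∀ w ∈ (P i j).support, w ∈ (P i' j').support →
        (w = b i ∨ w = b j) ∧ (w = b i' ∨ w = b j')) ∧
    K = ⨆ (i : Fin 4) (j : Fin 4) (_ : i < j), (P i j).toSubgraph

/-- `H` contains (at least) `k` pairwise edge-disjoint `K₄`-subdivisions. -/
def HasEdgeDisjointK4s (H : G.Subgraph) (k : ℕ) : Prop :=
  ∃ K : Fin k → G.Subgraph, (∀ i, IsK4Subdivision (K i) ∧ K i ≤ H) ∧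
    ∀ i j, i ≠ j → Disjoint (K i).edgeSet (K j).edgeSet

/-- `H` contains a `K₄`-subdivision. -/
def ContainsK4 (H : G.Subgraph) : Prop :=
  ∃ K : G.Subgraph, IsK4Subdivision K ∧ K ≤ H

/-- A non-trivial path of `G`. (It is stored with an orientation, which plays no role.) -/
structure Ear (G : SimpleGraph V) where
  fst : V
  snd : V
  walk : G.Walk fst snd
  isPath : walk.IsPath
  ne : fst ≠ snd

namespace Ear

/-- The path as a subgraph. -/
def toSubgraph (P : Ear G) : G.Subgraph := P.walk.toSubgraph

/-- The set of the two endvertices. -/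
def ends (P : Ear G) : Set V := {P.fst, P.snd}

/-- The set of interior vertices. -/
def interior (P : Ear G) : Set V := P.toSubgraph.verts \ P.ends

/-- The subpath of `P` between two of its vertices `a` and `b`
(there is exactly one `a`-`b`-path contained in `P`, so the union has one term). -/
def between (P : Ear G) (a b : V) : G.Subgraph :=
  ⨆ (q : G.Walk a b) (_ : q.IsPath ∧ q.toSubgraph ≤ P.toSubgraph), q.toSubgraph

/-- `P` is an `H`-path: it is non-trivial and meets the graph `H` exactly in its endvertices. -/
def IsPathOn (P : Ear G) (H : G.Subgraph) : Prop :=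
  P.toSubgraph.verts ∩ H.verts = P.ends ∧ Disjoint P.toSubgraph.edgeSet H.edgeSet

end Ear

/-- The union of a list of paths. -/
def earUnion (L : List (Ear G)) : G.Subgraph := ⨆ P ∈ L, P.toSubgraph

/-- `L` is an ear decomposition of `H` with terminals `s, t`
(the endvertices of the first ear, in any order). -/
def IsEarDecomposition (H : G.Subgraph) (s t : V) (L : List (Ear G)) : Prop :=
  (∃ P ∈ L.head?, s(P.fst, P.snd) = s(s, t)) ∧
  earUnion L = H ∧
  ∀ j : Fin L.length, 0 < (j : ℕ) → (L.get j).IsPathOn (earUnion (L.take j))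

/-- The `j`-th ear of `L` is nested in the `i`-th one: `i < j`, and the `i`-th ear
is the first ear that contains both endvertices of the `j`-th ear. -/
def IsNestedIn (L : List (Ear G)) (j i : Fin L.length) : Prop :=
  i < j ∧ (L.get j).ends ⊆ (L.get i).toSubgraph.verts ∧
    ∀ i' < i, ¬ (L.get j).ends ⊆ (L.get i').toSubgraph.verts

/-- The nest interval of the `j`-th ear, if it is nested in the `i`-th ear. -/
def nestInterval (L : List (Ear G)) (j i : Fin L.length) : G.Subgraph :=
  (L.get i).between (L.get j).fst (L.get j).snd

/-- `L` is a nested ear decomposition of `H` with terminals `s, t`. -/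
def IsNED (H : G.Subgraph) (s t : V) (L : List (Ear G)) : Prop :=
  IsEarDecomposition H s t L ∧
  (∀ j : Fin L.length, 0 < (j : ℕ) → ∃ i, IsNestedIn L j i) ∧
  ∀ i j j' : Fin L.length, IsNestedIn L j i → IsNestedIn L j' i →
    Disjoint (nestInterval L j i).edgeSet (nestInterval L j' i).edgeSet ∨
      nestInterval L j i ≤ nestInterval L j' i ∨ nestInterval L j' i ≤ nestInterval L j i

/-- The vertex set `X = N(x) ∪ {x}`. -/
def closedNbhd (G : SimpleGraph V) (x : V) : Set V := insert x (G.neighborSet x)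

/-- `N(S)`: the vertices outside `S` with a neighbour in `S`. -/
def outerNbhd (G : SimpleGraph V) (S : Set V) : Set V := {v | v ∉ S ∧ ∃ w ∈ S, G.Adj v w}

/-- `P` is an `x`-ear: its interior contains a vertex of `N(X)`. -/
def IsXEar (x : V) (P : Ear G) : Prop :=
  (P.interior ∩ outerNbhd G (closedNbhd G x)).Nonempty

/-- The graph `F̄`: the union of the ear `F` with all paths `v y x` of length 2 in `G`
from an interior vertex `v` of `F` to `x`. -/
def Ear.bar (x : V) (F : Ear G) : G.Subgraph :=
  F.toSubgraph ⊔ ⨆ (v : V) (y : V) (_ : v ∈ F.interior) (h : G.Adj v y) (h' : G.Adj y x),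
    G.subgraphOfAdj h ⊔ G.subgraphOfAdj h'

/-- The union of all `F̄` with `F` in `L`. -/
def barUnion (x : V) (L : List (Ear G)) : G.Subgraph := ⨆ F ∈ L, F.bar x

open Classical in
/-- The number of `x`-ears in `L`. -/
noncomputable def numXEars (x : V) (L : List (Ear G)) : ℕ :=
  L.countP fun P => decide (IsXEar x P)

open Classical in
/-- The number with binary digits `b₁ … bₙ`, where `bᵢ = 1` if the `i`-th ear is an `x`-ear, and
`bᵢ = 0` otherwise. -/
noncomputable def xEarCode (x : V) (L : List (Ear G)) : ℕ :=
  L.foldl (fun m P => 2 * m + if IsXEar x P then 1 else 0) 0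

/-- `L` is a good NED of `H` with terminals `s, t`, that is, a NED of `H - X` with these
terminals that has as many `x`-ears as possible and, subject to that, has its `x`-ears as
early as possible. -/
def IsGoodNED (x : V) (H : G.Subgraph) (s t : V) (L : List (Ear G)) : Prop :=
  IsNED (H.deleteVerts (closedNbhd G x)) s t L ∧
  (∀ L', IsNED (H.deleteVerts (closedNbhd G x)) s t L' → numXEars x L' ≤ numXEars x L) ∧
  ∀ L', IsNED (H.deleteVerts (closedNbhd G x)) s t L' → numXEars x L' = numXEars x L →
    xEarCode x L' ≤ xEarCode x L

/-- The `x`-ear number of `H` (with respect to terminals `s, t` of `H - X`): the number of `x`-ears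
in a good NED of `H`. All good NEDs have the same number; if there is no NED, because `H - X` is
a single vertex, then the value is `0`. -/
noncomputable def xEarNumber (x : V) (H : G.Subgraph) (s t : V) : ℕ :=
  sSup {n | ∃ L, IsGoodNED x H s t L ∧ numXEars x L = n}

/-- The standing assumptions on `G` and `x`: with `X = N(x) ∪ {x}`, all vertices of `X \ {x}`
have degree 2, `G - X` is 2-connected and series-parallel with some terminals, and `G` contains a
`K₄`-subdivision. -/
structure Standing (G : SimpleGraph V) (x : V) : Prop where
  degree_two : ∀ y, G.Adj x y → (G.neighborSet y).encard = 2
  two_connected : IsTwoConnected ((⊤ : G.Subgraph).deleteVerts (closedNbhd G x))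
  series_parallel : ∃ s t,
    IsSeriesParallel ((⊤ : G.Subgraph).deleteVerts (closedNbhd G x)) s t
  contains_K4 : ContainsK4 (⊤ : G.Subgraph)

end NestedEar

/-!
The argument works for an arbitrary ear decomposition `L` of the series-parallel graph `W = H - X`.
The vertices of `N(X)` are called *roots* below, so that an `x`-ear is an ear with a root in its
interior.

*Upper bound for ears.* A series-parallel construction of `W` determines two numbers `m` and `e`
(`RootedSP`): `m` counts tokens, one of which is created whenever two parts are put in parallel and
at least one of them carries a flag, and `e` is the flag, which says that every path between the
terminals has a root in its interior. By induction along the construction, `L` has at most `m + e`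
ears with interior roots (`RootedSP.countBound`).

*One subdivision from five tokens.* If `m ≥ 5`, then `W` has a triangle minor whose three branch
sets contain one root each, other than the terminals (`RootedSP.tri`); this comes from a chain of
weaker statements in which terminals replace roots, or an edge between the terminals is added.
Together with the branch set formed by `x` and its neighbours, that is a `K₄` minor, which contains
a subdivision of `K₄` as all degrees in `K₄` are three (`exists_isK4Subdivision`). It uses only
edges of `W` and of the paths of length 2 from interior roots to `x`; these edges are called the
supply of `W`.

*Packing.* The supplies of the two parts of a composition are disjoint, since vertices in `N(x)`
have degree 2. Hence one can process the construction from the bottom up, and take out a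
subdivision as soon as five tokens have accumulated. The graph that remains is either a
series-parallel graph with the same terminals (`Live`), or it is cut and consists of two pieces
that hang at the terminals (`Dead`). With an amortised count each subdivision pays for 26 tokens,
and at most 5 are left over in the end (`RootedSP.exists_packing`). So the number `λ` of `x`-ears
is at most `26 k + 5` for some number `k` of edge-disjoint subdivisions in the union of the `F̄`,
and for `λ ≥ 200` this gives `k ≥ ⌊λ / 200⌋ + 1`. For `λ < 200` a single subdivision is needed, and
one exists by assumption.
-/

namespace NestedEar

variable {V : Type*} {G : SimpleGraph V}

/-! ### Series-parallel graphs with roots -/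

open Classical in
/-- `1` if `v` is a root (a member of `R`), and `0` otherwise. -/
noncomputable def rootInd (R : Set V) (v : V) : ℕ := if v ∈ R then 1 else 0

lemma rootInd_le_one (R : Set V) (v : V) : rootInd R v ≤ 1 := by
  unfold rootInd; split <;> omega

lemma rootInd_of_mem {R : Set V} {v : V} (h : v ∈ R) : rootInd R v = 1 := if_pos h

lemma mem_of_rootInd {R : Set V} {v : V} (h : 1 ≤ rootInd R v) : v ∈ R := by
  unfold rootInd at h; split at h <;> [assumption; omega]

/-- A series-parallel graph with distinct terminals `s`, `t` that is built without single vertices,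
with edge-disjoint parts in each parallel composition, together with two numbers that are read off
the construction. The flag `e` is `1` if every `s`-`t` path has a root in its interior, and `0`
otherwise: it arises at a series composition whose common vertex is a root, persists in series with
any other part, and persists in parallel only if both parts have it. The number `m` of *tokens* is
additive, except that a parallel composition adds one if at least one of its parts has the flag. So
`m + e` bounds the number of paths with an interior root in an ear decomposition, and `m` bounds
the number of those after the first path. -/
inductive RootedSP (R : Set V) : G.Subgraph → V → V → ℕ → ℕ → Prop
  | edge {s t : V} (h : G.Adj s t) : RootedSP R (G.subgraphOfAdj h) s t 0 0
  | series {A B : G.Subgraph} {s r t : V} {mA eA mB eB : ℕ}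
      (hA : RootedSP R A s r mA eA) (hB : RootedSP R B r t mB eB)
      (h : A.verts ∩ B.verts = {r}) :
      RootedSP R (A ⊔ B) s t (mA + mB) (max (max eA eB) (rootInd R r))
  | parallel {A B : G.Subgraph} {s t : V} {mA eA mB eB : ℕ}
      (hA : RootedSP R A s t mA eA) (hB : RootedSP R B s t mB eB)
      (h : A.verts ∩ B.verts = {s, t}) (hd : Disjoint A.edgeSet B.edgeSet) :
      RootedSP R (A ⊔ B) s t (mA + mB + max eA eB) (min eA eB)

lemma inter_subset_of_eq {A B : G.Subgraph} {S : Set V} (h : A.verts ∩ B.verts = S) {v : V}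
    (hA : v ∈ A.verts) (hB : v ∈ B.verts) : v ∈ S := h ▸ ⟨hA, hB⟩

namespace RootedSP

variable {R : Set V} {W : G.Subgraph} {s t : V} {m e : ℕ}

lemma left_mem (h : RootedSP R W s t m e) : s ∈ W.verts := by
  induction h with
  | edge h => simp
  | series hA hB h ihA ihB => exact Or.inl ihA
  | parallel hA hB h hd ihA ihB => exact Or.inl ihA

lemma right_mem (h : RootedSP R W s t m e) : t ∈ W.verts := by
  induction h with
  | edge h => simp
  | series hA hB h ihA ihB => exact Or.inr ihB
  | parallel hA hB h hd ihA ihB => exact Or.inl ihA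

lemma ne (h : RootedSP R W s t m e) : s ≠ t := by
  induction h with
  | edge h => exact h.ne
  | @series A B s r t _ _ _ _ hA hB h ihA ihB =>
    rintro rfl
    exact ihA (inter_subset_of_eq h hA.left_mem hB.right_mem)
  | parallel hA hB h hd ihA ihB => exact ihA

lemma e_le_one (h : RootedSP R W s t m e) : e ≤ 1 := by
  induction h with
  | edge h => omega
  | @series A B s r t _ _ _ _ hA hB h ihA ihB => have := rootInd_le_one R r; omega
  | parallel hA hB h hd ihA ihB => omega

lemma symm (h : RootedSP R W s t m e) : RootedSP R W t s m e := by
  induction h with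
  | edge h =>
    rw [← SimpleGraph.subgraphOfAdj_symm h]
    exact .edge h.symm
  | @series A B s r t mA eA mB eB hA hB h ihA ihB =>
    rw [sup_comm A B, add_comm mA, max_comm eA]
    exact .series ihB ihA (by rw [Set.inter_comm, h])
  | parallel hA hB h hd ihA ihB =>
    exact .parallel ihA ihB (by rw [h, Set.pair_comm]) hd

lemma series_left_notMem {A B : G.Subgraph} {r : V} (hA : RootedSP R A s r m e)
    (h : A.verts ∩ B.verts = {r}) : s ∉ B.verts :=
  fun hs => hA.ne (inter_subset_of_eq h hA.left_mem hs)

end RootedSP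

lemma edgeSet_disjoint_of_inter_singleton {A B : G.Subgraph} {r : V}
    (h : A.verts ∩ B.verts = {r}) : Disjoint A.edgeSet B.edgeSet := by
  rw [Set.disjoint_left]
  intro e
  induction e with
  | _ u v =>
    intro h1 h2
    rw [SimpleGraph.Subgraph.mem_edgeSet] at h1 h2
    have hu : u = r := inter_subset_of_eq h h1.fst_mem h2.fst_mem
    have hv : v = r := inter_subset_of_eq h h1.snd_mem h2.snd_mem
    exact h1.ne (hu.trans hv.symm)

/-- Two parts in parallel that share no edge between the terminals share no edge at all. -/
lemma RootedSP.parallel_of_not_adj {R : Set V} {A B : G.Subgraph} {s t : V} {mA eA mB eB : ℕ}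
    (hA : RootedSP R A s t mA eA) (hB : RootedSP R B s t mB eB)
    (h : A.verts ∩ B.verts ⊆ {s, t}) (hn : ¬ (A.Adj s t ∧ B.Adj s t)) :
    RootedSP R (A ⊔ B) s t (mA + mB + max eA eB) (min eA eB) := by
  refine .parallel hA hB (h.antisymm ?_) ?_
  · rintro v (rfl | rfl)
    · exact ⟨hA.left_mem, hB.left_mem⟩
    · exact ⟨hA.right_mem, hB.right_mem⟩
  · rw [Set.disjoint_left]
    intro e
    induction e with
    | _ u v =>
      intro h1 h2
      rw [SimpleGraph.Subgraph.mem_edgeSet] at h1 h2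
      have hu := h ⟨h1.fst_mem, h2.fst_mem⟩
      have hv := h ⟨h1.snd_mem, h2.snd_mem⟩
      have := h1.ne
      rcases hu with rfl | rfl <;> rcases hv with rfl | rfl
      · exact this rfl
      · exact hn ⟨h1, h2⟩
      · exact hn ⟨h1.symm, h2.symm⟩
      · exact this rfl

/-- An edge between the two terminals can be split off. -/
lemma RootedSP.split_edge {R : Set V} {W : G.Subgraph} {s t : V} {m e : ℕ}
    (h : RootedSP R W s t m e) (hG : G.Adj s t) (hst : W.Adj s t) :
    W = G.subgraphOfAdj hG ∨
      ∃ W' m' e', RootedSP R W' s t m' e' ∧ ¬ W'.Adj s t ∧ W = W' ⊔ G.subgraphOfAdj hG := by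
  induction h with
  | edge h => exact Or.inl rfl
  | @series A B s r t mA eA mB eB hA hB h ihA ihB =>
    exfalso
    rcases SimpleGraph.Subgraph.sup_adj.1 hst with h1 | h1
    · exact hB.ne (inter_subset_of_eq h h1.snd_mem hB.right_mem).symm
    · exact hA.ne (inter_subset_of_eq h hA.left_mem h1.fst_mem)
  | @parallel A B s t mA eA mB eB hA hB h hd ihA ihB =>
    right
    have hnot : ¬ (A.Adj s t ∧ B.Adj s t) := fun h' =>
      Set.disjoint_left.1 hd (show s(s, t) ∈ A.edgeSet from h'.1) h'.2
    rcases SimpleGraph.Subgraph.sup_adj.1 hst with h1 | h1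
    · have hB1 : ¬ B.Adj s t := fun h2 => hnot ⟨h1, h2⟩
      rcases ihA hG h1 with rfl | ⟨W', m', e', hW', hn, rfl⟩
      · exact ⟨B, _, _, hB, hB1, sup_comm _ _⟩
      · refine ⟨W' ⊔ B, _, _, hW'.parallel_of_not_adj hB ?_ fun h => hn h.1, ?_,
          sup_right_comm _ _ _⟩
        · exact fun v hv => inter_subset_of_eq h (Or.inl hv.1) hv.2
        · rintro (h3 | h3)
          exacts [hn h3, hB1 h3]
    · have hA1 : ¬ A.Adj s t := fun h2 => hnot ⟨h2, h1⟩
      rcases ihB hG h1 with rfl | ⟨W', m', e', hW', hn, rfl⟩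
      · exact ⟨A, _, _, hA, hA1, rfl⟩
      · refine ⟨A ⊔ W', _, _, hA.parallel_of_not_adj hW' ?_ fun h => hn h.2, ?_,
          (sup_assoc _ _ _).symm⟩
        · exact fun v hv => inter_subset_of_eq h hv.1 (Or.inl hv.2)
        · rintro (h3 | h3)
          exacts [hA1 h3, hn h3]

lemma singletonSubgraph_le {W : G.Subgraph} {v : V} (h : v ∈ W.verts) :
    G.singletonSubgraph v ≤ W :=
  SimpleGraph.singletonSubgraph_le_iff _ _ |>.2 h

lemma IsSeriesParallel.terminals_mem {W : G.Subgraph} {s t : V} (h : IsSeriesParallel W s t) :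
    s ∈ W.verts ∧ t ∈ W.verts := by
  induction h with
  | vertex s => simp
  | edge h => simp
  | series h₁ h₂ h ih₁ ih₂ => exact ⟨Or.inl ih₁.1, Or.inr ih₂.2⟩
  | parallel h₁ h₂ h ih₁ ih₂ => exact ⟨Or.inl ih₁.1, Or.inl ih₁.2⟩

/-- Single vertices and multiple terminal edges can be eliminated from a series-parallel
construction. -/
lemma IsSeriesParallel.rootedSP (R : Set V) {W : G.Subgraph} {s t : V}
    (h : IsSeriesParallel W s t) :
    (s = t ∧ W = G.singletonSubgraph s) ∨ (s ≠ t ∧ ∃ m e, RootedSP R W s t m e) := by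
  induction h with
  | vertex s => exact Or.inl ⟨rfl, rfl⟩
  | edge h => exact Or.inr ⟨h.ne, _, _, .edge h⟩
  | @series A B s r t h₁ h₂ h ih₁ ih₂ =>
    rcases ih₁ with ⟨rfl, rfl⟩ | ⟨hsr, mA, eA, hA⟩
    · rw [sup_eq_right.2 (singletonSubgraph_le h₂.terminals_mem.1)]
      exact ih₂
    · rcases ih₂ with ⟨rfl, rfl⟩ | ⟨hrt, mB, eB, hB⟩
      · rw [sup_eq_left.2 (singletonSubgraph_le h₁.terminals_mem.2)]
        exact Or.inr ⟨hsr, mA, eA, hA⟩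
      · have := RootedSP.series hA hB h
        exact Or.inr ⟨this.ne, _, _, this⟩
  | @parallel A B s t h₁ h₂ h ih₁ ih₂ =>
    rcases ih₁ with ⟨rfl, rfl⟩ | ⟨hst, mA, eA, hA⟩
    · rcases ih₂ with ⟨_, rfl⟩ | ⟨hst, _⟩
      · exact Or.inl ⟨rfl, sup_idem _⟩
      · exact absurd rfl hst
    · rcases ih₂ with ⟨rfl, _⟩ | ⟨_, mB, eB, hB⟩
      · exact absurd rfl hst
      right
      refine ⟨hst, ?_⟩
      by_cases hAB : A.Adj s t ∧ B.Adj s t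
      · obtain ⟨hA1, hB1⟩ := hAB
        have hG : G.Adj s t := hA1.adj_sub
        have hle : G.subgraphOfAdj hG ≤ A := SimpleGraph.subgraphOfAdj_le_of_adj A hA1
        rcases hB.split_edge hG hB1 with rfl | ⟨B', m', e', hB', hn, rfl⟩
        · exact ⟨mA, eA, by rwa [sup_eq_left.2 hle]⟩
        · rw [← sup_assoc, sup_right_comm, sup_eq_left.2 hle]
          exact ⟨_, _, hA.parallel_of_not_adj hB'
            (fun v hv => inter_subset_of_eq h hv.1 (Or.inl hv.2)) fun h => hn h.2⟩
      · exact ⟨_, _, hA.parallel_of_not_adj hB h.le hAB⟩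

/-! ### Ears with interior roots -/

/-- Every path in the list is an ear on the union of `U` and the preceding paths. Compared to
`IsEarDecomposition`, the initial graph `U` is arbitrary, which makes inductions possible. -/
def EarSeq : G.Subgraph → List (Ear G) → Prop
  | _, [] => True
  | U, F :: L => F.IsPathOn U ∧ EarSeq (U ⊔ F.toSubgraph) L

open Classical in
/-- `1` if the subgraph `U` contains a root outside `Z`, and `0` otherwise. -/
noncomputable def hasRoot (R : Set V) (U : G.Subgraph) (Z : Set V) : ℕ :=
  if ((U.verts \ Z) ∩ R).Nonempty then 1 else 0

open Classical in
/-- The number of paths in the list that have a root in their interior. -/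
noncomputable def rootedCount (R : Set V) (L : List (Ear G)) : ℕ :=
  L.countP fun P => decide ((P.interior ∩ R).Nonempty)

lemma rootedCount_cons (R : Set V) (F : Ear G) (L : List (Ear G)) :
    rootedCount R (F :: L) = rootedCount R L + hasRoot R F.toSubgraph F.ends := by
  simp only [rootedCount, hasRoot, List.countP_cons, Ear.interior]
  split_ifs <;> simp_all

/-- The paths of the list that lie in `A`. -/
noncomputable def earsIn (A : G.Subgraph) (L : List (Ear G)) : List (Ear G) := by
  classical exact L.filter fun F => decide (F.toSubgraph ≤ A)

lemma earsIn_cons_of_le {A : G.Subgraph} {F : Ear G} (L : List (Ear G)) (h : F.toSubgraph ≤ A) :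
    earsIn A (F :: L) = F :: earsIn A L := by
  simp [earsIn, h]

lemma earsIn_cons_of_not_le {A : G.Subgraph} {F : Ear G} (L : List (Ear G))
    (h : ¬ F.toSubgraph ≤ A) : earsIn A (F :: L) = earsIn A L := by
  simp [earsIn, h]

lemma le_of_mem_earsIn {A : G.Subgraph} {L : List (Ear G)} {F : Ear G} (h : F ∈ earsIn A L) :
    F.toSubgraph ≤ A := by
  simp only [earsIn, List.mem_filter, decide_eq_true_eq] at h
  exact h.2

lemma rootedCount_le_add {R : Set V} {A B : G.Subgraph} {L : List (Ear G)}
    (h : ∀ F ∈ L, F.toSubgraph ≤ A ∨ F.toSubgraph ≤ B) :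
    rootedCount R L ≤ rootedCount R (earsIn A L) + rootedCount R (earsIn B L) := by
  induction L with
  | nil => simp [rootedCount]
  | cons F L ih =>
    have ih := ih fun F' hF' => h F' (List.mem_cons_of_mem _ hF')
    rw [rootedCount_cons]
    by_cases hA : F.toSubgraph ≤ A
    · rw [earsIn_cons_of_le L hA, rootedCount_cons]
      by_cases hB : F.toSubgraph ≤ B
      · rw [earsIn_cons_of_le L hB, rootedCount_cons]; omega
      · rw [earsIn_cons_of_not_le L hB]; omega
    · have hB := (h F List.mem_cons_self).resolve_left hA
      rw [earsIn_cons_of_not_le L hA, earsIn_cons_of_le L hB, rootedCount_cons]; omega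

lemma EarSeq.exists_isPathOn {U : G.Subgraph} {L : List (Ear G)} (h : EarSeq U L) {F : Ear G}
    (hF : F ∈ L) : ∃ U', U ≤ U' ∧ F.IsPathOn U' := by
  induction L generalizing U with
  | nil => simp at hF
  | cons F' L ih =>
    rcases List.mem_cons.1 hF with rfl | hF
    · exact ⟨U, le_rfl, h.1⟩
    · obtain ⟨U', h1, h2⟩ := ih h.2 hF
      exact ⟨U', le_sup_left.trans h1, h2⟩

/-- The paths of an ear sequence that lie in a part `A` form an ear sequence again, if all others
and the initial graph meet `A` in the new initial graph. -/
lemma EarSeq.earsIn {A U U' : G.Subgraph} {L : List (Ear G)} (h : EarSeq U L) (hU : U' ≤ U)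
    (hUA : ∀ v ∈ U.verts, v ∈ A.verts → v ∈ U'.verts)
    (hL : ∀ F ∈ L, ¬ F.toSubgraph ≤ A → ∀ v ∈ F.toSubgraph.verts, v ∈ A.verts → v ∈ U'.verts) :
    EarSeq U' (earsIn A L) := by
  induction L generalizing U U' with
  | nil => simp [NestedEar.earsIn, EarSeq]
  | cons F L ih =>
    obtain ⟨⟨h1, h2⟩, h3⟩ := h
    by_cases hF : F.toSubgraph ≤ A
    · rw [earsIn_cons_of_le L hF]
      refine ⟨⟨?_, h2.mono_right (SimpleGraph.Subgraph.edgeSet_mono hU)⟩,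
        ih h3 (sup_le_sup_right hU _) ?_ ?_⟩
      · refine Set.Subset.antisymm (fun v hv => h1 ▸ ⟨hv.1, hU.1 hv.2⟩) fun v hv => ?_
        rw [← h1] at hv
        exact ⟨hv.1, hUA v hv.2 (hF.1 hv.1)⟩
      · rintro v (hv | hv) hvA
        exacts [Or.inl (hUA v hv hvA), Or.inr hv]
      · exact fun F' hF' h v hv hvA => Or.inl (hL F' (List.mem_cons_of_mem _ hF') h v hv hvA)
    · rw [earsIn_cons_of_not_le L hF]
      refine ih h3 (hU.trans le_sup_left) ?_ fun F' hF' => hL F' (List.mem_cons_of_mem _ hF')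
      rintro v (hv | hv) hvA
      exacts [hUA v hv hvA, hL F List.mem_cons_self hF v hv hvA]

/-- A path in the union of two subgraphs lies in one of them, if its interior avoids
their intersection. -/
lemma walk_le_or_le {A B : G.Subgraph} {u v : V} (p : G.Walk u v) (hp : p.IsPath) (huv : u ≠ v)
    (hle : p.toSubgraph ≤ A ⊔ B)
    (hZ : ∀ z ∈ p.support, z ∈ A.verts → z ∈ B.verts → z = u ∨ z = v) :
    p.toSubgraph ≤ A ∨ p.toSubgraph ≤ B := by
  induction p with
  | nil => exact absurd rfl huv
  | @cons u w v h q ih =>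
    rw [SimpleGraph.Walk.toSubgraph] at hle ⊢
    rw [SimpleGraph.Walk.cons_isPath_iff] at hp
    have hadj : A.Adj u w ∨ B.Adj u w := by
      have : (G.subgraphOfAdj h ⊔ q.toSubgraph).Adj u w := Or.inl rfl
      exact hle.2 this
    by_cases hwv : w = v
    · subst hwv
      obtain rfl := (SimpleGraph.Walk.isPath_iff_nil.1 hp.1).eq_nil
      refine hadj.imp (fun h' => ?_) fun h' => ?_
      · exact sup_le (SimpleGraph.subgraphOfAdj_le_of_adj _ h') (singletonSubgraph_le h'.snd_mem)
      · exact sup_le (SimpleGraph.subgraphOfAdj_le_of_adj _ h') (singletonSubgraph_le h'.snd_mem)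
    · have hw : ¬ (w ∈ A.verts ∧ w ∈ B.verts) := fun hw =>
        (hZ w (by simp) hw.1 hw.2).elim (fun h' => h.ne h'.symm) hwv
      have hwq : w ∈ q.toSubgraph.verts := by simp
      rcases ih hp.1 hwv (le_sup_right.trans hle) (fun z hz hA hB =>
        (hZ z (by simp [hz]) hA hB).elim (fun h' => absurd (h' ▸ hz) hp.2) Or.inr) with hq | hq
      · refine Or.inl (sup_le (SimpleGraph.subgraphOfAdj_le_of_adj _ ?_) hq)
        exact hadj.resolve_right fun h' => hw ⟨hq.1 hwq, h'.snd_mem⟩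
      · refine Or.inr (sup_le (SimpleGraph.subgraphOfAdj_le_of_adj _ ?_) hq)
        exact hadj.resolve_left fun h' => hw ⟨h'.snd_mem, hq.1 hwq⟩

/-- An ear on a graph that contains the intersection of `A` and `B` does not change between
`A` and `B`. -/
lemma Ear.le_or_le {A B U : G.Subgraph} {F : Ear G} (hF : F.IsPathOn U)
    (hle : F.toSubgraph ≤ A ⊔ B) (hU : ∀ z, z ∈ A.verts → z ∈ B.verts → z ∈ U.verts) :
    F.toSubgraph ≤ A ∨ F.toSubgraph ≤ B := by
  refine walk_le_or_le F.walk F.isPath F.ne hle fun z hz hA hB => ?_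
  have : z ∈ F.ends := by
    rw [← hF.1]
    exact ⟨(SimpleGraph.Walk.mem_verts_toSubgraph _).2 hz, hU z hA hB⟩
  exact this

lemma exists_adj_of_ne {u v : V} (p : G.Walk u v) (h : u ≠ v) :
    ∃ a b, p.toSubgraph.Adj a b := by
  cases p with
  | nil => exact absurd rfl h
  | cons h' q => exact ⟨_, _, Or.inl rfl⟩

/-- An ear with the endvertices `s` and `t` can be traversed from `s` to `t`. -/
lemma Ear.exists_walk {F : Ear G} {s t : V} (hs : F.ends = {s, t}) :
    ∃ q : G.Walk s t, q.IsPath ∧ q.toSubgraph = F.toSubgraph := by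
  obtain ⟨a, b, p, hp, hne⟩ := F
  have h : ({a, b} : Set V) = {s, t} := hs
  rw [Set.pair_eq_pair_iff] at h
  obtain ⟨rfl, rfl⟩ | ⟨rfl, rfl⟩ := h
  · exact ⟨p, hp, rfl⟩
  · exact ⟨p.reverse, hp.reverse, SimpleGraph.Walk.toSubgraph_reverse p⟩

/-- In every ear sequence in `W` that starts from an `s`-`t` path, at most `m` of the further ears
have a root in their interior, and at most `m + e` if the first path is included. -/
def CountBound (R : Set V) (W : G.Subgraph) (s t : V) (m e : ℕ) : Prop :=
  ∀ p : G.Walk s t, p.IsPath → p.toSubgraph ≤ W → ∀ L, EarSeq p.toSubgraph L →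
    (∀ F ∈ L, F.toSubgraph ≤ W) →
    rootedCount R L ≤ m ∧ rootedCount R L + hasRoot R p.toSubgraph {s, t} ≤ m + e

lemma countBound_edge (R : Set V) {s t : V} (h : G.Adj s t) :
    CountBound R (G.subgraphOfAdj h) s t 0 0 := by
  intro p hp hpW L hL hLW
  have h0 : hasRoot R p.toSubgraph {s, t} = 0 := by
    refine if_neg ?_
    rintro ⟨v, ⟨hv, hv'⟩, -⟩
    exact hv' (hpW.1 hv)
  have hadj : p.toSubgraph.Adj s t := by
    obtain ⟨a, b, hab⟩ := exists_adj_of_ne p h.ne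
    have h1 : s(s, t) = s(a, b) := hpW.2 hab
    rw [Sym2.eq_iff] at h1
    rcases h1 with ⟨rfl, rfl⟩ | ⟨rfl, rfl⟩
    exacts [hab, hab.symm]
  cases L with
  | nil => simp [rootedCount, h0]
  | cons F L =>
    exfalso
    obtain ⟨a, b, hab⟩ := exists_adj_of_ne F.walk F.ne
    have h1 : s(s, t) = s(a, b) := (hLW F List.mem_cons_self).2 hab
    exact Set.disjoint_left.1 hL.1.2 (show s(a, b) ∈ F.toSubgraph.edgeSet from hab)
      (by rw [← h1]; exact hadj)

/-- The initial path passes the common vertex `r`, and splits there into an initial path of each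
part; every ear lies in one of the parts. -/
lemma countBound_series {R : Set V} {A B : G.Subgraph} {s r t : V} {mA eA mB eB : ℕ}
    (hA : RootedSP R A s r mA eA) (hB : RootedSP R B r t mB eB) (h : A.verts ∩ B.verts = {r})
    (cA : CountBound R A s r mA eA) (cB : CountBound R B r t mB eB) :
    CountBound R (A ⊔ B) s t (mA + mB) (max (max eA eB) (rootInd R r)) := by
  classical
  intro p hp hpW L hL hLW
  have hAB : ∀ v, v ∈ A.verts → v ∈ B.verts → v = r := fun v h1 h2 => inter_subset_of_eq h h1 h2
  have hs : s ∉ B.verts := fun h' => hA.ne (hAB s hA.left_mem h')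
  have ht : t ∉ A.verts := fun h' => hB.ne (hAB t h' hB.right_mem).symm
  have hst : s ≠ t := (hA.series hB h).ne
  have hr : r ∈ p.support := by
    by_contra hr
    rcases walk_le_or_le p hp hst hpW fun z hz h1 h2 =>
      absurd (hAB z h1 h2 ▸ hz) hr with h1 | h1
    · exact ht (h1.1 (by simp))
    · exact hs (h1.1 (by simp))
  have hspec : p.toSubgraph = (p.takeUntil r hr).toSubgraph ⊔ (p.dropUntil r hr).toSubgraph := by
    rw [← SimpleGraph.Walk.toSubgraph_append, SimpleGraph.Walk.take_spec]
  have hp₁ := hp.takeUntil hr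
  have hp₂ := hp.dropUntil hr
  generalize p.takeUntil r hr = p₁ at hspec hp₁
  generalize p.dropUntil r hr = p₂ at hspec hp₂
  have hle₁ : p₁.toSubgraph ≤ A := by
    refine (walk_le_or_le p₁ hp₁ hA.ne ((hspec ▸ le_sup_left).trans hpW) fun z _ h1 h2 =>
      Or.inr (hAB z h1 h2)).resolve_right fun h1 => hs (h1.1 (by simp))
  have hle₂ : p₂.toSubgraph ≤ B := by
    refine (walk_le_or_le p₂ hp₂ hB.ne ((hspec ▸ le_sup_right).trans hpW) fun z _ h1 h2 =>
      Or.inl (hAB z h1 h2)).resolve_left fun h1 => ht (h1.1 (by simp))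
  have hr₁ : r ∈ p₁.toSubgraph.verts := by simp
  have hr₂ : r ∈ p₂.toSubgraph.verts := by simp
  -- the common vertex lies on the initial path, so it is not interior to any ear
  have hor : ∀ F ∈ L, F.toSubgraph ≤ A ∨ F.toSubgraph ≤ B := by
    intro F hF
    obtain ⟨U, hU, hFU⟩ := hL.exists_isPathOn hF
    refine Ear.le_or_le hFU (hLW F hF) fun z h1 h2 => ?_
    rw [hAB z h1 h2]
    exact hU.1 (by rw [hspec]; exact Or.inl hr₁)
  have hvert : ∀ v ∈ p.toSubgraph.verts, v ∈ p₁.toSubgraph.verts ∨ v ∈ p₂.toSubgraph.verts := by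
    intro v hv
    rwa [hspec] at hv
  obtain ⟨a1, a2⟩ := cA p₁ hp₁ hle₁ (earsIn A L) (hL.earsIn (hspec ▸ le_sup_left)
    (fun v hv hvA => (hvert v hv).elim id fun h' => hAB v hvA (hle₂.1 h') ▸ hr₁)
    fun F hF hFA v hv hvA => hAB v hvA (((hor F hF).resolve_left hFA).1 hv) ▸ hr₁)
    fun F hF => le_of_mem_earsIn hF
  obtain ⟨b1, b2⟩ := cB p₂ hp₂ hle₂ (earsIn B L) (hL.earsIn (hspec ▸ le_sup_right)
    (fun v hv hvB => (hvert v hv).elim (fun h' => hAB v (hle₁.1 h') hvB ▸ hr₂) id)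
    fun F hF hFB v hv hvB => hAB v (((hor F hF).resolve_right hFB).1 hv) hvB ▸ hr₂)
    fun F hF => le_of_mem_earsIn hF
  have hc := rootedCount_le_add (R := R) hor
  have hroot : hasRoot R p.toSubgraph {s, t} ≤ max (max (hasRoot R p₁.toSubgraph {s, r})
      (hasRoot R p₂.toSubgraph {r, t})) (rootInd R r) := by
    by_cases hne : ((p.toSubgraph.verts \ {s, t}) ∩ R).Nonempty
    · rw [hasRoot, if_pos hne]
      obtain ⟨v, ⟨hv, hv'⟩, hvR⟩ := hne
      by_cases hvr : v = r
      · subst hvr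
        rw [rootInd_of_mem hvR]
        exact le_max_right _ _
      · simp only [Set.mem_insert_iff, Set.mem_singleton_iff, not_or] at hv'
        refine le_max_of_le_left ?_
        rcases hvert v hv with h1 | h1
        · refine le_max_of_le_left ?_
          rw [hasRoot, if_pos ⟨v, ⟨h1, by simp [hv', hvr]⟩, hvR⟩]
        · refine le_max_of_le_right ?_
          rw [hasRoot, if_pos ⟨v, ⟨h1, by simp [hv', hvr]⟩, hvR⟩]
    · rw [hasRoot, if_neg hne]
      omega
  exact ⟨by omega, by omega⟩

/-- The bound for parallel parts, if the first path lies in `A`. The first of the ears in `B`, if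
there is one, connects the terminals, so it plays the role of the first path there. -/
lemma countBound_parallel_left {R : Set V} {A B : G.Subgraph} {s t : V} {mA eA mB eB : ℕ}
    (h : A.verts ∩ B.verts = {s, t})
    (cA : CountBound R A s t mA eA) (cB : CountBound R B s t mB eB)
    {p : G.Walk s t} (hp : p.IsPath) (hpA : p.toSubgraph ≤ A) {L : List (Ear G)}
    (hL : EarSeq p.toSubgraph L) (hLW : ∀ F ∈ L, F.toSubgraph ≤ A ⊔ B) :
    rootedCount R L ≤ mA + mB + max eA eB ∧
      rootedCount R L + hasRoot R p.toSubgraph {s, t} ≤ mA + mB + max eA eB + min eA eB := by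
  have hAB : ∀ v, v ∈ A.verts → v ∈ B.verts → v = s ∨ v = t :=
    fun v h1 h2 => inter_subset_of_eq h h1 h2
  have hps : s ∈ p.toSubgraph.verts := by simp
  have hpt : t ∈ p.toSubgraph.verts := by simp
  have hABp : ∀ v, v ∈ A.verts → v ∈ B.verts → v ∈ p.toSubgraph.verts := by
    intro v h1 h2
    rcases hAB v h1 h2 with rfl | rfl <;> assumption
  have hor : ∀ F ∈ L, F.toSubgraph ≤ A ∨ F.toSubgraph ≤ B := by
    intro F hF
    obtain ⟨U, hU, hFU⟩ := hL.exists_isPathOn hF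
    exact Ear.le_or_le hFU (hLW F hF) fun z h1 h2 => hU.1 (hABp z h1 h2)
  obtain ⟨a1, a2⟩ := cA p hp hpA (earsIn A L) (hL.earsIn le_rfl (fun v hv _ => hv)
    fun F hF hFA v hv hvA => hABp v hvA (((hor F hF).resolve_left hFA).1 hv))
    fun F hF => le_of_mem_earsIn hF
  have hc := rootedCount_le_add (R := R) hor
  -- the ears in `B` form an ear sequence on the two isolated terminals
  set U₀ : G.Subgraph := G.singletonSubgraph s ⊔ G.singletonSubgraph t with hU₀
  have hmem : ∀ v, v ∈ U₀.verts ↔ v = s ∨ v = t := fun v => by simp [hU₀, or_comm]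
  have hB : EarSeq U₀ (earsIn B L) := by
    refine hL.earsIn (sup_le (singletonSubgraph_le hps) (singletonSubgraph_le hpt))
      (fun v hv hvB => (hmem v).2 (hAB v (hpA.1 hv) hvB))
      fun F hF hFB v hv hvB => (hmem v).2 (hAB v (((hor F hF).resolve_right hFB).1 hv) hvB)
  have hLB : ∀ F ∈ earsIn B L, F.toSubgraph ≤ B := fun F hF => le_of_mem_earsIn hF
  generalize earsIn B L = LB at hc hB hLB
  cases LB with
  | nil =>
    simp only [rootedCount, List.countP_nil] at hc a1 a2 ⊢
    omega
  | cons F L' =>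
    obtain ⟨⟨h1, -⟩, h2⟩ := hB
    have hends : F.ends = {s, t} := by
      have hsub : ∀ v ∈ F.ends, v = s ∨ v = t := fun v hv => by
        rw [← h1] at hv; exact (hmem v).1 hv.2
      have hne := F.ne
      have hf := hsub F.fst (Or.inl rfl)
      have hsn := hsub F.snd (Or.inr rfl)
      rw [Ear.ends, Set.pair_eq_pair_iff]
      grind
    obtain ⟨q, hq, hqF⟩ := Ear.exists_walk hends
    have h3 : U₀ ⊔ F.toSubgraph = q.toSubgraph := by
      rw [hqF, sup_eq_right, ← hqF]
      exact sup_le (singletonSubgraph_le (by simp)) (singletonSubgraph_le (by simp))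
    rw [h3] at h2
    obtain ⟨b1, b2⟩ := cB q hq (hqF ▸ hLB F List.mem_cons_self) L' h2
      fun F' hF' => hLB F' (List.mem_cons_of_mem _ hF')
    rw [rootedCount_cons, hends, ← hqF] at hc
    omega

/-- The numbers of a series-parallel graph bound the paths with interior roots in each of its ear
decompositions. -/
lemma RootedSP.countBound {R : Set V} {W : G.Subgraph} {s t : V} {m e : ℕ}
    (h : RootedSP R W s t m e) : CountBound R W s t m e := by
  induction h with
  | edge h => exact countBound_edge R h
  | series hA hB h ihA ihB => exact countBound_series hA hB h ihA ihB
  | @parallel A B s t mA eA mB eB hA hB h hd ihA ihB =>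
    intro p hp hpW L hL hLW
    have hor := walk_le_or_le p hp hA.ne hpW fun z _ h1 h2 => inter_subset_of_eq h h1 h2
    rcases hor with hpA | hpB
    · exact countBound_parallel_left h ihA ihB hp hpA hL hLW
    · have := countBound_parallel_left (by rwa [Set.inter_comm]) ihB ihA hp hpB hL
        (by rwa [sup_comm])
      rwa [add_comm mB, max_comm, min_comm] at this

/-! ### Rooted triangle minors -/

/-- Any two vertices of `B` are joined by a walk inside `B`. -/
def Conn (Γ : SimpleGraph V) (B : Set V) : Prop :=
  ∀ a ∈ B, ∀ b ∈ B, ∃ p : Γ.Walk a b, ∀ v ∈ p.support, v ∈ B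

/-- There is an edge between `A` and `B`. -/
def Touch (Γ : SimpleGraph V) (A B : Set V) : Prop := ∃ a ∈ A, ∃ b ∈ B, Γ.Adj a b

lemma Touch.symm {Γ : SimpleGraph V} {A B : Set V} (h : Touch Γ A B) : Touch Γ B A := by
  obtain ⟨a, ha, b, hb, hab⟩ := h
  exact ⟨b, hb, a, ha, hab.symm⟩

lemma Touch.mono {Γ Γ' : SimpleGraph V} {A B A' B' : Set V} (h : Touch Γ A B) (hΓ : Γ ≤ Γ')
    (hA : A ⊆ A') (hB : B ⊆ B') : Touch Γ' A' B' := by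
  obtain ⟨a, ha, b, hb, hab⟩ := h
  exact ⟨a, hA ha, b, hB hb, hΓ hab⟩

namespace Conn

variable {Γ Γ' : SimpleGraph V} {A B : Set V}

lemma of_subsingleton {v : V} (h : B ⊆ {v}) : Conn Γ B := by
  intro a ha b hb
  obtain rfl : a = v := h ha
  obtain rfl : b = a := h hb
  exact ⟨.nil, by simpa using hb⟩

lemma mono (hB : Conn Γ B) (h : Γ ≤ Γ') : Conn Γ' B := by
  intro a ha b hb
  obtain ⟨p, hp⟩ := hB a ha b hb
  exact ⟨p.mapLe h, by simpa using hp⟩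

lemma union_of_mem (hA : Conn Γ A) (hB : Conn Γ B) {v : V} (hvA : v ∈ A) (hvB : v ∈ B) :
    Conn Γ (A ∪ B) := by
  have key : ∀ a ∈ A ∪ B, ∃ p : Γ.Walk a v, ∀ w ∈ p.support, w ∈ A ∪ B := by
    rintro a (ha | ha)
    · obtain ⟨p, hp⟩ := hA a ha v hvA
      exact ⟨p, fun w hw => Or.inl (hp w hw)⟩
    · obtain ⟨p, hp⟩ := hB a ha v hvB
      exact ⟨p, fun w hw => Or.inr (hp w hw)⟩
  intro a ha b hb
  obtain ⟨p, hp⟩ := key a ha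
  obtain ⟨q, hq⟩ := key b hb
  refine ⟨p.append q.reverse, fun w hw => ?_⟩
  rw [SimpleGraph.Walk.mem_support_append_iff, SimpleGraph.Walk.support_reverse,
    List.mem_reverse] at hw
  exact hw.elim (hp w) (hq w)

lemma pair {u v : V} (h : Γ.Adj u v) : Conn Γ {u, v} := by
  have key : ∀ a b : V, Γ.Adj a b → ∃ p : Γ.Walk a b, ∀ w ∈ p.support, w = a ∨ w = b :=
    fun a b h => ⟨h.toWalk, by simp⟩
  rintro a (rfl | rfl) b (rfl | rfl)
  · exact ⟨.nil, by simp⟩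
  · exact key _ _ h
  · obtain ⟨p, hp⟩ := key _ _ h.symm
    exact ⟨p, fun w hw => (hp w hw).symm⟩
  · exact ⟨.nil, by simp⟩

lemma union_of_touch (hA : Conn Γ A) (hB : Conn Γ B) (h : Touch Γ A B) : Conn Γ (A ∪ B) := by
  obtain ⟨u, hu, v, hv, huv⟩ := h
  have h1 := (hA.union_of_mem (pair huv) hu (by simp)).union_of_mem hB (v := v) (by simp) hv
  convert h1 using 1
  ext w
  simp only [Set.mem_union, Set.mem_insert_iff, Set.mem_singleton_iff]
  grind

/-- Connectedness lifts along the replacement of vertices by connected sets. -/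
lemma biUnion {β : V → Set V} (hB : Conn Γ' B) (hβ : ∀ u, Conn Γ (β u))
    (hadj : ∀ u v, Γ'.Adj u v → Touch Γ (β u) (β v)) : Conn Γ (⋃ u ∈ B, β u) := by
  have key : ∀ {u v : V} (p : Γ'.Walk u v), (∀ w ∈ p.support, w ∈ B) →
      ∀ a ∈ β u, ∀ b ∈ β v, ∃ q : Γ.Walk a b, ∀ w ∈ q.support, w ∈ ⋃ u ∈ B, β u := by
    intro u v p
    induction p with
    | nil =>
      intro h a ha b hb
      obtain ⟨q, hq⟩ := hβ _ a ha b hb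
      exact ⟨q, fun w hw => Set.mem_biUnion (h _ (by simp)) (hq w hw)⟩
    | @cons u w v huw p ih =>
      intro h a ha b hb
      obtain ⟨c, hc, d, hd, hcd⟩ := hadj u w huw
      obtain ⟨q, hq⟩ := hβ _ a ha c hc
      obtain ⟨q', hq'⟩ := ih (fun z hz => h z (by simp [hz])) d hd b hb
      refine ⟨q.append (.cons hcd q'), fun z hz => ?_⟩
      rw [SimpleGraph.Walk.mem_support_append_iff, SimpleGraph.Walk.support_cons,
        List.mem_cons] at hz
      have hu : u ∈ B := h u (by simp)
      rcases hz with hz | rfl | hz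
      · exact Set.mem_biUnion hu (hq z hz)
      · exact Set.mem_biUnion hu hc
      · exact hq' z hz
  intro a ha b hb
  simp only [Set.mem_iUnion] at ha hb
  obtain ⟨u, hu, ha⟩ := ha
  obtain ⟨v, hv, hb⟩ := hb
  obtain ⟨p, hp⟩ := hB u hu v hv
  exact key p hp a ha b hb

end Conn

/-- The graph `Γ` has a triangle minor whose three branch sets meet `D₁`, `D₂` and `D₃`,
respectively. -/
def Tri (Γ : SimpleGraph V) (D₁ D₂ D₃ : Set V) : Prop :=
  ∃ B₁ B₂ B₃ : Set V, (Conn Γ B₁ ∧ Conn Γ B₂ ∧ Conn Γ B₃) ∧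
    ((∃ v ∈ B₁, v ∈ D₁) ∧ (∃ v ∈ B₂, v ∈ D₂) ∧ ∃ v ∈ B₃, v ∈ D₃) ∧
    ((∀ v ∈ B₁, v ∉ B₂) ∧ (∀ v ∈ B₁, v ∉ B₃) ∧ ∀ v ∈ B₂, v ∉ B₃) ∧
    Touch Γ B₁ B₂ ∧ Touch Γ B₁ B₃ ∧ Touch Γ B₂ B₃

/-- A triangle minor lifts along the replacement of vertices by connected sets. -/
lemma Tri.transfer {Γ Γ' : SimpleGraph V} {β : V → Set V} {D₁ D₂ D₃ D₁' D₂' D₃' : Set V}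
    (h : Tri Γ' D₁ D₂ D₃) (hβ : ∀ u, Conn Γ (β u))
    (hdisj : ∀ u v, u ≠ v → ∀ a ∈ β u, a ∉ β v)
    (hadj : ∀ u v, Γ'.Adj u v → Touch Γ (β u) (β v))
    (h₁ : ∀ u ∈ D₁, ∃ v ∈ β u, v ∈ D₁') (h₂ : ∀ u ∈ D₂, ∃ v ∈ β u, v ∈ D₂')
    (h₃ : ∀ u ∈ D₃, ∃ v ∈ β u, v ∈ D₃') : Tri Γ D₁' D₂' D₃' := by
  obtain ⟨B₁, B₂, B₃, ⟨c1, c2, c3⟩, ⟨m1, m2, m3⟩, ⟨d1, d2, d3⟩, t1, t2, t3⟩ := h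
  have hM : ∀ {B D D' : Set V}, (∀ u ∈ D, ∃ v ∈ β u, v ∈ D') → (∃ v ∈ B, v ∈ D) →
      ∃ v ∈ ⋃ u ∈ B, β u, v ∈ D' := by
    rintro B D D' h ⟨u, hu, hD⟩
    obtain ⟨v, hv, hv'⟩ := h u hD
    exact ⟨v, Set.mem_biUnion hu hv, hv'⟩
  have hd : ∀ {B B' : Set V}, (∀ v ∈ B, v ∉ B') → ∀ v ∈ ⋃ u ∈ B, β u, v ∉ ⋃ u ∈ B', β u := by
    intro B B' h v hv hv'
    simp only [Set.mem_iUnion] at hv hv'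
    obtain ⟨u, hu, hv⟩ := hv
    obtain ⟨u', hu', hv'⟩ := hv'
    exact hdisj u u' (fun he => h u hu (he ▸ hu')) v hv hv'
  have ht : ∀ {B B' : Set V}, Touch Γ' B B' → Touch Γ (⋃ u ∈ B, β u) (⋃ u ∈ B', β u) := by
    rintro B B' ⟨a, ha, b, hb, hab⟩
    exact (hadj a b hab).mono le_rfl (Set.subset_biUnion_of_mem (u := β) ha)
      (Set.subset_biUnion_of_mem (u := β) hb)
  exact ⟨_, _, _, ⟨c1.biUnion hβ hadj, c2.biUnion hβ hadj, c3.biUnion hβ hadj⟩,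
    ⟨hM h₁ m1, hM h₂ m2, hM h₃ m3⟩, ⟨hd d1, hd d2, hd d3⟩, ht t1, ht t2, ht t3⟩

/-- A triangle minor of a graph on `S` remains one when two vertices `s`, `t` of `S` are blown up to
disjoint connected sets `P`, `Q` that meet `S` only there; an edge `st` need not survive if `P` and
`Q` touch. A branch set that meets `Dᵢ` in `s` or `t` may use a vertex of `P` or `Q` instead. -/
lemma Tri.attach {Γ Γ' : SimpleGraph V} {S P Q : Set V} {s t : V}
    {D₁ D₂ D₃ D₁' D₂' D₃' : Set V}
    (h : Tri Γ' D₁ D₂ D₃) (hst : s ≠ t) (hs : s ∈ P) (ht : t ∈ Q)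
    (hP : Conn Γ P) (hQ : Conn Γ Q) (hPQ : ∀ v ∈ P, v ∉ Q)
    (hPS : ∀ v ∈ P, v ∈ S → v = s) (hQS : ∀ v ∈ Q, v ∈ S → v = t)
    (hadj : ∀ u v, Γ'.Adj u v → u ∈ S ∧ v ∈ S ∧
      (Γ.Adj u v ∨ ((u = s ∧ v = t ∨ u = t ∧ v = s) ∧ Touch Γ P Q)))
    (h₁ : ∀ u ∈ D₁, u ∈ S ∧ u ∈ D₁' ∨ (u = s ∧ ∃ v ∈ P, v ∈ D₁') ∨ (u = t ∧ ∃ v ∈ Q, v ∈ D₁'))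
    (h₂ : ∀ u ∈ D₂, u ∈ S ∧ u ∈ D₂' ∨ (u = s ∧ ∃ v ∈ P, v ∈ D₂') ∨ (u = t ∧ ∃ v ∈ Q, v ∈ D₂'))
    (h₃ : ∀ u ∈ D₃, u ∈ S ∧ u ∈ D₃' ∨ (u = s ∧ ∃ v ∈ P, v ∈ D₃') ∨ (u = t ∧ ∃ v ∈ Q, v ∈ D₃')) :
    Tri Γ D₁' D₂' D₃' := by
  classical
  -- vertices of `P ∪ Q` other than `s`, `t` get an empty branch set: they are not in `S`
  set β : V → Set V := fun u => if u = s then P else if u = t then Q else {u} \ (P ∪ Q) with hβ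
  have hβs : β s = P := by simp [hβ]
  have hβt : β t = Q := by simp [hβ, hst.symm]
  have hβu : ∀ u, u ≠ s → u ≠ t → β u = {u} \ (P ∪ Q) := fun u h1 h2 => by simp [hβ, h1, h2]
  have hmem : ∀ u ∈ S, u ∈ β u := by
    intro u hu
    by_cases h1 : u = s
    · subst h1; rwa [hβs]
    by_cases h2 : u = t
    · subst h2; rwa [hβt]
    rw [hβu u h1 h2]
    exact ⟨rfl, fun h => h.elim (fun h => h1 (hPS u h hu)) fun h => h2 (hQS u h hu)⟩
  have hD : ∀ D D' : Set V, (∀ u ∈ D, u ∈ S ∧ u ∈ D' ∨ (u = s ∧ ∃ v ∈ P, v ∈ D') ∨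
      (u = t ∧ ∃ v ∈ Q, v ∈ D')) → ∀ u ∈ D, ∃ v ∈ β u, v ∈ D' := by
    intro D D' h u hu
    rcases h u hu with ⟨h1, h2⟩ | ⟨rfl, h⟩ | ⟨rfl, h⟩
    · exact ⟨u, hmem u h1, h2⟩
    · rwa [hβs]
    · rwa [hβt]
  refine h.transfer (β := β) ?_ ?_ ?_ (hD _ _ h₁) (hD _ _ h₂) (hD _ _ h₃)
  · intro u
    by_cases h1 : u = s
    · subst h1; rwa [hβs]
    by_cases h2 : u = t
    · subst h2; rwa [hβt]
    rw [hβu u h1 h2]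
    exact .of_subsingleton Set.sdiff_subset
  · intro u v huv a ha hb
    have hβm : ∀ w, a ∈ β w → (w = s ∧ a ∈ P) ∨ (w = t ∧ a ∈ Q) ∨ (a = w ∧ a ∉ P ∧ a ∉ Q) := by
      intro w hw
      by_cases h1 : w = s
      · subst h1; exact Or.inl ⟨rfl, hβs ▸ hw⟩
      by_cases h2 : w = t
      · subst h2; exact Or.inr (Or.inl ⟨rfl, hβt ▸ hw⟩)
      rw [hβu w h1 h2] at hw
      exact Or.inr (Or.inr ⟨hw.1, fun h => hw.2 (Or.inl h), fun h => hw.2 (Or.inr h)⟩)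
    have h1 := hβm u ha
    have h2 := hβm v hb
    have h3 := hPQ a
    clear * - h1 h2 h3 huv
    grind
  · intro u v huv
    obtain ⟨hu, hv, h | ⟨⟨rfl, rfl⟩ | ⟨rfl, rfl⟩, h⟩⟩ := hadj u v huv
    · exact ⟨u, hmem u hu, v, hmem v hv, h⟩
    · rwa [hβs, hβt]
    · rw [hβs, hβt]; exact h.symm

lemma Tri.mono {Γ Γ' : SimpleGraph V} {D₁ D₂ D₃ : Set V} (h : Tri Γ D₁ D₂ D₃) (hΓ : Γ ≤ Γ') :
    Tri Γ' D₁ D₂ D₃ := by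
  obtain ⟨B₁, B₂, B₃, ⟨c1, c2, c3⟩, hm, hd, t1, t2, t3⟩ := h
  exact ⟨B₁, B₂, B₃, ⟨c1.mono hΓ, c2.mono hΓ, c3.mono hΓ⟩, hm, hd, t1.mono hΓ le_rfl le_rfl,
    t2.mono hΓ le_rfl le_rfl, t3.mono hΓ le_rfl le_rfl⟩

/-- The graph `W` with an additional edge `st`. -/
def closeUp (W : G.Subgraph) (s t : V) : SimpleGraph V := W.spanningCoe ⊔ SimpleGraph.edge s t

lemma closeUp_comm (W : G.Subgraph) (s t : V) : closeUp W s t = closeUp W t s := by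
  rw [closeUp, closeUp, SimpleGraph.edge_comm]

lemma closeUp_adj {W : G.Subgraph} {s t u v : V} (h : (closeUp W s t).Adj u v) :
    W.Adj u v ∨ (u = s ∧ v = t ∨ u = t ∧ v = s) := by
  rcases h with h | h
  · exact Or.inl h
  · rw [SimpleGraph.edge_adj] at h
    exact Or.inr (by tauto)

lemma closeUp_adj_terminals {W : G.Subgraph} {s t : V} (h : s ≠ t) : (closeUp W s t).Adj s t :=
  Or.inr (by rw [SimpleGraph.edge_adj]; exact ⟨Or.inl ⟨rfl, rfl⟩, h⟩)

lemma le_closeUp (W : G.Subgraph) (s t : V) : W.spanningCoe ≤ closeUp W s t := le_sup_left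

lemma coe_le_sup_left (A B : G.Subgraph) : A.spanningCoe ≤ (A ⊔ B).spanningCoe :=
  fun _ _ h => Or.inl h

lemma coe_le_sup_right (A B : G.Subgraph) : B.spanningCoe ≤ (A ⊔ B).spanningCoe :=
  fun _ _ h => Or.inr h

/-- The roots in `W` other than the terminals. -/
def innerRoots (R : Set V) (W : G.Subgraph) (s t : V) : Set V :=
  {v | v ∈ W.verts ∧ v ≠ s ∧ v ≠ t ∧ v ∈ R}

lemma innerRoots_comm (R : Set V) (W : G.Subgraph) (s t : V) :
    innerRoots R W s t = innerRoots R W t s := by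
  ext v; simp only [innerRoots, Set.mem_ofPred_eq]; tauto

/-- An `s`-`r`-`t` path minor with a root `r`: three disjoint connected sets `P`, `M`, `Q`, with
edges from `P` to `M` and from `M` to `Q`, such that `s ∈ P`, `t ∈ Q`, and `M` contains a root. -/
def RootChain (R : Set V) (W : G.Subgraph) (s t : V) : Prop :=
  ∃ P M Q : Set V, (∀ v, v ∈ P ∨ v ∈ M ∨ v ∈ Q → v ∈ W.verts) ∧
    (Conn W.spanningCoe P ∧ Conn W.spanningCoe M ∧ Conn W.spanningCoe Q) ∧
    s ∈ P ∧ t ∈ Q ∧ (∃ v ∈ M, v ∈ R) ∧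
    ((∀ v ∈ P, v ∉ M) ∧ (∀ v ∈ P, v ∉ Q) ∧ ∀ v ∈ M, v ∉ Q) ∧
    Touch W.spanningCoe P M ∧ Touch W.spanningCoe M Q

lemma RootChain.symm {R : Set V} {W : G.Subgraph} {s t : V} (h : RootChain R W s t) :
    RootChain R W t s := by
  obtain ⟨P, M, Q, hW, ⟨c1, c2, c3⟩, hs, ht, hM, ⟨d1, d2, d3⟩, t1, t2⟩ := h
  exact ⟨Q, M, P, by grind, ⟨c3, c2, c1⟩, ht, hs, hM, by grind, t2.symm, t1.symm⟩

lemma RootChain.exists_innerRoot {R : Set V} {W : G.Subgraph} {s t : V}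
    (h : RootChain R W s t) : ∃ v, v ∈ innerRoots R W s t := by
  obtain ⟨P, M, Q, hW, -, hs, ht, ⟨v, hv, hvR⟩, ⟨d1, d2, d3⟩, -⟩ := h
  exact ⟨v, hW v (by simp [hv]), by grind, by grind, hvR⟩

namespace RootedSP

variable {R : Set V} {W A B : G.Subgraph} {s r t : V} {m e mA eA mB eB : ℕ}

/-- A series-parallel graph remains connected when a terminal is deleted. -/
lemma conn_diff_right (h : RootedSP R W s t m e) :
    Conn W.spanningCoe (W.verts \ {t}) ∧ Touch W.spanningCoe (W.verts \ {t}) {t} := by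
  induction h with
  | @edge s t h =>
    refine ⟨.of_subsingleton (v := s) ?_, s, ?_, t, rfl, ?_⟩
    · rintro v ⟨rfl | rfl, h⟩
      · rfl
      · exact absurd rfl h
    · exact ⟨by simp, h.ne⟩
    · simpa using h.ne
  | @series A B s r t mA eA mB eB hA hB h ihA ihB =>
    have ht : t ∉ A.verts := fun ht => hB.ne (inter_subset_of_eq h ht hB.right_mem).symm
    have h1 : Conn A.spanningCoe A.verts := by
      have := ihA.1.union_of_touch (.of_subsingleton (v := r) subset_rfl) ihA.2
      rwa [Set.sdiff_union_of_subset (by simpa using hA.right_mem)] at this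
    have h2 : (A ⊔ B).verts \ {t} = A.verts ∪ (B.verts \ {t}) := by
      ext v
      simp only [SimpleGraph.Subgraph.verts_sup, Set.mem_sdiff, Set.mem_union,
        Set.mem_singleton_iff]
      grind
    rw [h2]
    refine ⟨(h1.mono (coe_le_sup_left A B)).union_of_mem (ihB.1.mono (coe_le_sup_right A B))
      hA.right_mem ⟨hB.left_mem, hB.ne⟩, ihB.2.mono (coe_le_sup_right A B) ?_ subset_rfl⟩
    exact Set.subset_union_right
  | @parallel A B s t mA eA mB eB hA hB h hd ihA ihB =>
    have h2 : (A ⊔ B).verts \ {t} = A.verts \ {t} ∪ (B.verts \ {t}) := by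
      rw [SimpleGraph.Subgraph.verts_sup, Set.union_sdiff_distrib]
    rw [h2]
    refine ⟨(ihA.1.mono (coe_le_sup_left A B)).union_of_mem (ihB.1.mono (coe_le_sup_right A B))
      ⟨hA.left_mem, hA.ne⟩ ⟨hB.left_mem, hB.ne⟩, ihB.2.mono (coe_le_sup_right A B) ?_ subset_rfl⟩
    exact Set.subset_union_right

lemma conn_diff_left (h : RootedSP R W s t m e) : Conn W.spanningCoe (W.verts \ {s}) :=
  h.symm.conn_diff_right.1

lemma touch_diff_left (h : RootedSP R W s t m e) :
    Touch W.spanningCoe {s} (W.verts \ {s}) := h.symm.conn_diff_right.2.symm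

lemma conn (h : RootedSP R W s t m e) : Conn W.spanningCoe W.verts := by
  have := h.conn_diff_right.1.union_of_touch (.of_subsingleton (v := t) subset_rfl)
    h.conn_diff_right.2
  rwa [Set.sdiff_union_of_subset (by simpa using h.right_mem)] at this

lemma innerRoots_series_left (hB : RootedSP R B r t mB eB)
    (h : A.verts ∩ B.verts = {r}) : innerRoots R A s r ⊆ innerRoots R (A ⊔ B) s t := by
  rintro v ⟨h1, h2, h3, h4⟩
  refine ⟨Or.inl h1, h2, ?_, h4⟩
  rintro rfl
  exact h3 (inter_subset_of_eq h h1 hB.right_mem)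

lemma innerRoots_series_right (hA : RootedSP R A s r mA eA)
    (h : A.verts ∩ B.verts = {r}) : innerRoots R B r t ⊆ innerRoots R (A ⊔ B) s t := by
  rintro v ⟨h1, h2, h3, h4⟩
  refine ⟨Or.inr h1, ?_, h3, h4⟩
  rintro rfl
  exact h2 (inter_subset_of_eq h hA.left_mem h1)

lemma mem_innerRoots_series (hA : RootedSP R A s r mA eA) (hB : RootedSP R B r t mB eB)
    (hr : r ∈ R) : r ∈ innerRoots R (A ⊔ B) s t :=
  ⟨Or.inl hA.right_mem, hA.ne.symm, hB.ne, hr⟩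

lemma innerRoots_parallel_left : innerRoots R A s t ⊆ innerRoots R (A ⊔ B) s t :=
  fun _ h => ⟨Or.inl h.1, h.2⟩

lemma innerRoots_parallel_right : innerRoots R B s t ⊆ innerRoots R (A ⊔ B) s t :=
  fun _ h => ⟨Or.inr h.1, h.2⟩

end RootedSP

open RootedSP

section

variable {R : Set V} {W A B : G.Subgraph} {s r t : V} {m e mA eA mB eB : ℕ}

lemma RootChain.series_left (hc : RootChain R A s r) (hB : RootedSP R B r t mB eB)
    (h : A.verts ∩ B.verts = {r}) : RootChain R (A ⊔ B) s t := by
  obtain ⟨P, M, Q, hW, ⟨c1, c2, c3⟩, hs, ht, hM, ⟨d1, d2, d3⟩, t1, t2⟩ := hc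
  have hl := coe_le_sup_left A B
  have hAB : ∀ v, v ∈ A.verts → v ∈ B.verts → v = r := fun v h1 h2 => inter_subset_of_eq h h1 h2
  refine ⟨P, M, Q ∪ B.verts, ?_, ⟨c1.mono hl, c2.mono hl, (c3.mono hl).union_of_mem
    (hB.conn.mono (coe_le_sup_right A B)) ht hB.left_mem⟩, hs, Or.inr hB.right_mem, hM, ?_,
    t1.mono hl le_rfl le_rfl, t2.mono hl le_rfl Set.subset_union_left⟩
  · rw [SimpleGraph.Subgraph.verts_sup]; grind
  · grind

lemma RootChain.mono (hc : RootChain R A s t) (h : A ≤ W) : RootChain R W s t := by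
  obtain ⟨P, M, Q, hW, ⟨c1, c2, c3⟩, hs, ht, hM, hd, t1, t2⟩ := hc
  have hl : A.spanningCoe ≤ W.spanningCoe := fun _ _ h' => h.2 h'
  exact ⟨P, M, Q, fun v hv => h.1 (hW v hv), ⟨c1.mono hl, c2.mono hl, c3.mono hl⟩, hs, ht, hM, hd,
    t1.mono hl le_rfl le_rfl, t2.mono hl le_rfl le_rfl⟩

/-- If the numbers of `W` are not both zero, some connection of the terminals passes an
interior root. -/
lemma RootedSP.rootChain (h : RootedSP R W s t m e) (hν : 1 ≤ m + e) : RootChain R W s t := by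
  induction h with
  | edge h => omega
  | @series A B s r t mA eA mB eB hA hB h ihA ihB =>
    by_cases h1 : 1 ≤ mA + eA
    · exact (ihA h1).series_left hB h
    by_cases h2 : 1 ≤ mB + eB
    · rw [sup_comm]
      exact ((ihB h2).symm.series_left hA.symm (by rwa [Set.inter_comm])).symm
    have hr : r ∈ R := mem_of_rootInd (by omega)
    have hl := coe_le_sup_left A B
    have hl' := coe_le_sup_right A B
    have hAB : ∀ v, v ∈ A.verts → v ∈ B.verts → v = r := fun v h1 h2 => inter_subset_of_eq h h1 h2
    have := hA.right_mem
    refine ⟨A.verts \ {r}, {r}, B.verts \ {r}, ?_, ⟨hA.conn_diff_right.1.mono hl,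
      .of_subsingleton subset_rfl, hB.conn_diff_left.mono hl'⟩, ⟨hA.left_mem, hA.ne⟩,
      ⟨hB.right_mem, hB.ne.symm⟩, ⟨r, rfl, hr⟩, ?_, hA.conn_diff_right.2.mono hl le_rfl le_rfl,
      hB.touch_diff_left.mono hl' le_rfl le_rfl⟩
    · rw [SimpleGraph.Subgraph.verts_sup]; grind
    · grind
  | @parallel A B s t mA eA mB eB hA hB h hd ihA ihB =>
    by_cases h1 : 1 ≤ mA + eA
    · exact (ihA h1).mono le_sup_left
    · exact (ihB (by omega)).mono le_sup_right

/-- A triangle minor in the closed-up part `A` of a series composition `A ⊔ B` extends: the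
other part `B` is contracted to the common terminal. -/
lemma Tri.series_closeUp {D₁ D₂ D₃ D₁' D₂' D₃' : Set V} (hA : RootedSP R A s r mA eA)
    (hB : RootedSP R B r t mB eB) (h : A.verts ∩ B.verts = {r}) (hT : Tri (closeUp A s r) D₁ D₂ D₃)
    (h₁ : ∀ u ∈ D₁, u ∈ A.verts ∧ u ∈ D₁' ∨ (u = r ∧ ∃ v ∈ B.verts, v ∈ D₁'))
    (h₂ : ∀ u ∈ D₂, u ∈ A.verts ∧ u ∈ D₂' ∨ (u = r ∧ ∃ v ∈ B.verts, v ∈ D₂'))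
    (h₃ : ∀ u ∈ D₃, u ∈ A.verts ∧ u ∈ D₃' ∨ (u = r ∧ ∃ v ∈ B.verts, v ∈ D₃')) :
    Tri (closeUp (A ⊔ B) s t) D₁' D₂' D₃' := by
  have hs := series_left_notMem hA h
  have hl' := (coe_le_sup_right A B).trans (le_closeUp (A ⊔ B) s t)
  have hst : s ≠ t := fun h => hs (h ▸ hB.right_mem)
  refine hT.attach (S := A.verts) (P := {s}) (Q := B.verts) hA.ne rfl hB.left_mem
    (.of_subsingleton subset_rfl) (hB.conn.mono hl') ?_ ?_ ?_ ?_
    (fun u hu => (h₁ u hu).imp_right Or.inr) (fun u hu => (h₂ u hu).imp_right Or.inr)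
    (fun u hu => (h₃ u hu).imp_right Or.inr)
  · rintro v rfl; exact hs
  · rintro v rfl _; rfl
  · exact fun v h1 h2 => inter_subset_of_eq h h2 h1
  · intro u v huv
    rcases closeUp_adj huv with h1 | h1
    · exact ⟨h1.fst_mem, h1.snd_mem, Or.inl (Or.inl (Or.inl h1))⟩
    · have := hA.left_mem
      have := hA.right_mem
      exact ⟨by grind, by grind,
        Or.inr ⟨h1, s, rfl, t, hB.right_mem, closeUp_adj_terminals hst⟩⟩

/-- A triangle minor in the part `A` of a series composition `A ⊔ B` extends: the
other part `B` is contracted to the common terminal. -/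
lemma Tri.series {D₁ D₂ D₃ D₁' D₂' D₃' : Set V} (hA : RootedSP R A s r mA eA)
    (hB : RootedSP R B r t mB eB) (h : A.verts ∩ B.verts = {r}) (hT : Tri A.spanningCoe D₁ D₂ D₃)
    (h₁ : ∀ u ∈ D₁, u ∈ A.verts ∧ u ∈ D₁' ∨ (u = r ∧ ∃ v ∈ B.verts, v ∈ D₁'))
    (h₂ : ∀ u ∈ D₂, u ∈ A.verts ∧ u ∈ D₂' ∨ (u = r ∧ ∃ v ∈ B.verts, v ∈ D₂'))
    (h₃ : ∀ u ∈ D₃, u ∈ A.verts ∧ u ∈ D₃' ∨ (u = r ∧ ∃ v ∈ B.verts, v ∈ D₃')) :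
    Tri (A ⊔ B).spanningCoe D₁' D₂' D₃' := by
  have hs := series_left_notMem hA h
  refine hT.attach (S := A.verts) (P := {s}) (Q := B.verts) hA.ne rfl hB.left_mem
    (.of_subsingleton subset_rfl) (hB.conn.mono (coe_le_sup_right A B)) ?_ ?_ ?_ ?_
    (fun u hu => (h₁ u hu).imp_right Or.inr) (fun u hu => (h₂ u hu).imp_right Or.inr)
    (fun u hu => (h₃ u hu).imp_right Or.inr)
  · rintro v rfl; exact hs
  · rintro v rfl _; rfl
  · exact fun v h1 h2 => inter_subset_of_eq h h2 h1
  · intro u v (h1 : A.Adj u v)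
    exact ⟨h1.fst_mem, h1.snd_mem, Or.inl (Or.inl h1)⟩

/-- In a parallel composition `A ⊔ B`, the part `B` plays the role of the edge that
closes up `A`. -/
lemma Tri.parallel {D₁ D₂ D₃ D₁' D₂' D₃' : Set V} (hA : RootedSP R A s t mA eA)
    (hB : RootedSP R B s t mB eB) (h : A.verts ∩ B.verts = {s, t})
    (hT : Tri (closeUp A s t) D₁ D₂ D₃)
    (h₁ : ∀ u ∈ D₁, u ∈ A.verts ∧ u ∈ D₁') (h₂ : ∀ u ∈ D₂, u ∈ A.verts ∧ u ∈ D₂')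
    (h₃ : ∀ u ∈ D₃, u ∈ A.verts ∧ u ∈ D₃') :
    Tri (A ⊔ B).spanningCoe D₁' D₂' D₃' := by
  have hl' := coe_le_sup_right A B
  refine hT.attach (S := A.verts) (P := {s}) (Q := B.verts \ {s}) hA.ne rfl
    ⟨hB.right_mem, hB.ne.symm⟩ (.of_subsingleton subset_rfl) (hB.conn_diff_left.mono hl')
    ?_ ?_ ?_ ?_ (fun u hu => Or.inl (h₁ u hu)) (fun u hu => Or.inl (h₂ u hu))
    (fun u hu => Or.inl (h₃ u hu))
  · rintro v rfl h; exact h.2 rfl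
  · rintro v rfl _; rfl
  · exact fun v h1 h2 => (inter_subset_of_eq h h2 h1.1).resolve_left h1.2
  · intro u v huv
    rcases closeUp_adj huv with h1 | h1
    · exact ⟨h1.fst_mem, h1.snd_mem, Or.inl (Or.inl h1)⟩
    · have := hA.left_mem
      have := hA.right_mem
      exact ⟨by grind, by grind, Or.inr ⟨h1, hB.touch_diff_left.mono hl' le_rfl le_rfl⟩⟩

end

/-! ### Rooted triangle minors in series-parallel graphs -/

section

variable {R : Set V} {W A B : G.Subgraph} {s r t : V} {m e mA eA mB eB : ℕ}

/-- Chains in both parts of a series composition close up to a cycle through the terminals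
and two roots. -/
lemma tri_series_of_chains (hA : RootedSP R A s r mA eA) (hB : RootedSP R B r t mB eB)
    (h : A.verts ∩ B.verts = {r}) (cA : RootChain R A s r) (cB : RootChain R B r t)
    {D : Set V} (hD : s ∈ D ∨ t ∈ D) :
    Tri (closeUp (A ⊔ B) s t) D (innerRoots R (A ⊔ B) s t) (innerRoots R (A ⊔ B) s t) := by
  have hst : s ≠ t := (hA.series hB h).ne
  have hAB : ∀ v, v ∈ A.verts → v ∈ B.verts → v = r := fun v h1 h2 => inter_subset_of_eq h h1 h2
  have hl := (coe_le_sup_left A B).trans (le_closeUp (A ⊔ B) s t)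
  have hl' := (coe_le_sup_right A B).trans (le_closeUp (A ⊔ B) s t)
  have hadj := closeUp_adj_terminals (W := A ⊔ B) hst
  obtain ⟨P, M, Q, hW, ⟨c1, c2, c3⟩, hs, hr, ⟨v, hv, hvR⟩, ⟨d1, d2, d3⟩, t1, t2⟩ := cA
  obtain ⟨P', M', Q', hW', ⟨c1', c2', c3'⟩, hr', ht, ⟨v', hv', hvR'⟩, ⟨d1', d2', d3'⟩,
    t1', t2'⟩ := cB
  have hvI : v ∈ innerRoots R (A ⊔ B) s t :=
    innerRoots_series_left hB h ⟨hW v (by simp [hv]), by grind, by grind, hvR⟩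
  have hvI' : v' ∈ innerRoots R (A ⊔ B) s t :=
    innerRoots_series_right hA h ⟨hW' v' (by simp [hv']), by grind, by grind, hvR'⟩
  refine ⟨P ∪ Q', M ∪ Q ∪ P', M', ⟨?_, ?_, c2'.mono hl'⟩, ⟨?_, ⟨v, by simp [hv], hvI⟩,
    ⟨v', hv', hvI'⟩⟩, ?_, ?_, ?_, ?_⟩
  · exact (c1.mono hl).union_of_touch (c3'.mono hl') ⟨s, hs, t, ht, hadj⟩
  · exact ((c2.mono hl).union_of_touch (c3.mono hl) (t2.mono hl le_rfl le_rfl)).union_of_mem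
      (c1'.mono hl') (Or.inr hr) hr'
  · rcases hD with hD | hD
    exacts [⟨s, Or.inl hs, hD⟩, ⟨t, Or.inr ht, hD⟩]
  · refine ⟨?_, ?_, ?_⟩ <;> grind
  · exact t1.mono hl Set.subset_union_left (fun w hw => Or.inl (Or.inl hw))
  · exact t2'.symm.mono hl' Set.subset_union_right le_rfl
  · exact t1'.mono hl' Set.subset_union_right le_rfl

/-- If the common vertex in a series composition is a root, then a chain in one part closes up to a
cycle through the terminals and two roots. -/
lemma tri_series_of_root (hA : RootedSP R A s r mA eA) (hB : RootedSP R B r t mB eB)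
    (h : A.verts ∩ B.verts = {r}) (cA : RootChain R A s r) (hrR : r ∈ R)
    {D : Set V} (hD : s ∈ D ∨ t ∈ D) :
    Tri (closeUp (A ⊔ B) s t) D (innerRoots R (A ⊔ B) s t) (innerRoots R (A ⊔ B) s t) := by
  have hst : s ≠ t := (hA.series hB h).ne
  have hAB : ∀ v, v ∈ A.verts → v ∈ B.verts → v = r := fun v h1 h2 => inter_subset_of_eq h h1 h2
  have hl := (coe_le_sup_left A B).trans (le_closeUp (A ⊔ B) s t)
  have hl' := (coe_le_sup_right A B).trans (le_closeUp (A ⊔ B) s t)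
  have hadj := closeUp_adj_terminals (W := A ⊔ B) hst
  have htB : t ∈ B.verts \ {r} := ⟨hB.right_mem, hB.ne.symm⟩
  obtain ⟨P, M, Q, hW, ⟨c1, c2, c3⟩, hs, hr, ⟨v, hv, hvR⟩, ⟨d1, d2, d3⟩, t1, t2⟩ := cA
  have hvI : v ∈ innerRoots R (A ⊔ B) s t :=
    innerRoots_series_left hB h ⟨hW v (by simp [hv]), by grind, by grind, hvR⟩
  refine ⟨P ∪ (B.verts \ {r}), M, Q, ⟨?_, c2.mono hl, c3.mono hl⟩, ⟨?_, ⟨v, hv, hvI⟩,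
    ⟨r, hr, mem_innerRoots_series hA hB hrR⟩⟩, ?_, ?_, ?_, t2.mono hl le_rfl le_rfl⟩
  · exact (c1.mono hl).union_of_touch (hB.conn_diff_left.mono hl') ⟨s, hs, t, htB, hadj⟩
  · rcases hD with hD | hD
    exacts [⟨s, Or.inl hs, hD⟩, ⟨t, Or.inr htB, hD⟩]
  · refine ⟨?_, ?_, ?_⟩ <;> grind
  · exact t1.mono hl Set.subset_union_left le_rfl
  · exact (hB.touch_diff_left.mono hl' (Set.singleton_subset_iff.2 hr)
      Set.subset_union_right).symm

/-- If both parts of a series composition have chains through roots, and the common vertex is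
a root, then there is a cycle through three roots after closing up. -/
lemma tri_series_three_roots (hA : RootedSP R A s r mA eA) (hB : RootedSP R B r t mB eB)
    (h : A.verts ∩ B.verts = {r}) (cA : RootChain R A s r) (cB : RootChain R B r t)
    (hrR : r ∈ R) :
    Tri (closeUp (A ⊔ B) s t) (innerRoots R (A ⊔ B) s t) (innerRoots R (A ⊔ B) s t)
      (innerRoots R (A ⊔ B) s t) := by
  have hst : s ≠ t := (hA.series hB h).ne
  have hAB : ∀ v, v ∈ A.verts → v ∈ B.verts → v = r := fun v h1 h2 => inter_subset_of_eq h h1 h2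
  have hl := (coe_le_sup_left A B).trans (le_closeUp (A ⊔ B) s t)
  have hl' := (coe_le_sup_right A B).trans (le_closeUp (A ⊔ B) s t)
  have hadj := closeUp_adj_terminals (W := A ⊔ B) hst
  obtain ⟨P, M, Q, hW, ⟨c1, c2, c3⟩, hs, hr, ⟨v, hv, hvR⟩, ⟨d1, d2, d3⟩, t1, t2⟩ := cA
  obtain ⟨P', M', Q', hW', ⟨c1', c2', c3'⟩, hr', ht, ⟨v', hv', hvR'⟩, ⟨d1', d2', d3'⟩,
    t1', t2'⟩ := cB
  have hvI : v ∈ innerRoots R (A ⊔ B) s t :=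
    innerRoots_series_left hB h ⟨hW v (by simp [hv]), by grind, by grind, hvR⟩
  have hvI' : v' ∈ innerRoots R (A ⊔ B) s t :=
    innerRoots_series_right hA h ⟨hW' v' (by simp [hv']), by grind, by grind, hvR'⟩
  refine ⟨M, Q ∪ P', M' ∪ Q' ∪ P, ⟨c2.mono hl, ?_, ?_⟩, ⟨⟨v, hv, hvI⟩,
    ⟨r, Or.inl hr, mem_innerRoots_series hA hB hrR⟩, ⟨v', by simp [hv'], hvI'⟩⟩, ?_, ?_, ?_, ?_⟩
  · exact (c3.mono hl).union_of_mem (c1'.mono hl') hr hr'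
  · exact ((c2'.mono hl').union_of_touch (c3'.mono hl') (t2'.mono hl' le_rfl le_rfl)).union_of_touch
      (c1.mono hl) ⟨t, Or.inr ht, s, hs, hadj.symm⟩
  · refine ⟨?_, ?_, ?_⟩ <;> grind
  · exact t2.mono hl le_rfl Set.subset_union_left
  · exact t1.symm.mono hl le_rfl Set.subset_union_right
  · exact t1'.mono hl' Set.subset_union_right (fun w hw => Or.inl (Or.inl hw))

/-- Two parallel chains form a cycle through the terminals and two roots. -/
lemma tri_parallel_of_chains (h : A.verts ∩ B.verts = {s, t}) (cA : RootChain R A s t)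
    (cB : RootChain R B s t) :
    Tri (A ⊔ B).spanningCoe {s} (innerRoots R (A ⊔ B) s t) (innerRoots R (A ⊔ B) s t) := by
  have hAB : ∀ v, v ∈ A.verts → v ∈ B.verts → v = s ∨ v = t :=
    fun v h1 h2 => inter_subset_of_eq h h1 h2
  have hl := coe_le_sup_left A B
  have hl' := coe_le_sup_right A B
  obtain ⟨P, M, Q, hW, ⟨c1, c2, c3⟩, hs, ht, ⟨v, hv, hvR⟩, ⟨d1, d2, d3⟩, t1, t2⟩ := cA
  obtain ⟨P', M', Q', hW', ⟨c1', c2', c3'⟩, hs', ht', ⟨v', hv', hvR'⟩, ⟨d1', d2', d3'⟩,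
    t1', t2'⟩ := cB
  refine ⟨P ∪ P', M, M' ∪ Q' ∪ Q, ⟨?_, c2.mono hl, ?_⟩, ⟨⟨s, Or.inl hs, rfl⟩,
    ⟨v, hv, Or.inl (hW v (by simp [hv])), by grind, by grind, hvR⟩,
    ⟨v', by simp [hv'], Or.inr (hW' v' (by simp [hv'])), by grind, by grind, hvR'⟩⟩, ?_, ?_, ?_, ?_⟩
  · exact (c1.mono hl).union_of_mem (c1'.mono hl') hs hs'
  · exact ((c2'.mono hl').union_of_touch (c3'.mono hl') (t2'.mono hl' le_rfl le_rfl)).union_of_mem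
      (c3.mono hl) (Or.inr ht') ht
  · refine ⟨?_, ?_, ?_⟩ <;> grind
  · exact t1.mono hl Set.subset_union_left le_rfl
  · exact t1'.mono hl' Set.subset_union_right (fun w hw => Or.inl (Or.inl hw))
  · exact t2.mono hl le_rfl Set.subset_union_right

/-- A chain in one of two parallel parts lies on a cycle through the terminals. -/
lemma tri_parallel_of_chain (hB : RootedSP R B s t mB eB) (h : A.verts ∩ B.verts = {s, t})
    (cA : RootChain R A s t) :
    Tri (A ⊔ B).spanningCoe {s} {t} (innerRoots R (A ⊔ B) s t) := by
  have hAB : ∀ v, v ∈ A.verts → v ∈ B.verts → v = s ∨ v = t :=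
    fun v h1 h2 => inter_subset_of_eq h h1 h2
  have hl := coe_le_sup_left A B
  have hl' := coe_le_sup_right A B
  have htB : t ∈ B.verts \ {s} := ⟨hB.right_mem, hB.ne.symm⟩
  obtain ⟨P, M, Q, hW, ⟨c1, c2, c3⟩, hs, ht, ⟨v, hv, hvR⟩, ⟨d1, d2, d3⟩, t1, t2⟩ := cA
  refine ⟨P, Q ∪ (B.verts \ {s}), M, ⟨c1.mono hl, ?_, c2.mono hl⟩, ⟨⟨s, hs, rfl⟩,
    ⟨t, Or.inl ht, rfl⟩,
    ⟨v, hv, Or.inl (hW v (by simp [hv])), by grind, by grind, hvR⟩⟩, ?_, ?_, ?_, ?_⟩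
  · exact (c3.mono hl).union_of_mem (hB.conn_diff_left.mono hl') ht htB
  · refine ⟨?_, ?_, ?_⟩ <;> grind
  · exact hB.touch_diff_left.mono hl' (Set.singleton_subset_iff.2 hs) Set.subset_union_right
  · exact t1.mono hl le_rfl le_rfl
  · exact t2.symm.mono hl Set.subset_union_left le_rfl

/-- A triangle minor at the terminal `s` of one part takes up a root from a chain in the
parallel part. -/
lemma Tri.parallel_chain (hA : RootedSP R A s t mA eA)
    (h : A.verts ∩ B.verts = {s, t}) (cB : RootChain R B s t)
    (hT : Tri (closeUp A s t) {s} (innerRoots R A s t) (innerRoots R A s t)) :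
    Tri (A ⊔ B).spanningCoe (innerRoots R (A ⊔ B) s t) (innerRoots R (A ⊔ B) s t)
      (innerRoots R (A ⊔ B) s t) := by
  have hAB : ∀ v, v ∈ A.verts → v ∈ B.verts → v = s ∨ v = t :=
    fun v h1 h2 => inter_subset_of_eq h h1 h2
  have hl' := coe_le_sup_right A B
  obtain ⟨P', M', Q', hW', ⟨c1', c2', c3'⟩, hs', ht', ⟨v', hv', hvR'⟩, ⟨d1', d2', d3'⟩,
    t1', t2'⟩ := cB
  have hI : ∀ u ∈ innerRoots R A s t, u ∈ A.verts ∧ u ∈ innerRoots R (A ⊔ B) s t :=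
    fun u hu => ⟨hu.1, innerRoots_parallel_left hu⟩
  refine hT.attach (S := A.verts) (P := P' ∪ M') (Q := Q') hA.ne (Or.inl hs') ht'
    ((c1'.mono hl').union_of_touch (c2'.mono hl') (t1'.mono hl' le_rfl le_rfl)) (c3'.mono hl')
    (by grind) (by grind) (by grind) ?_ ?_ (fun u hu => Or.inl (hI u hu))
    (fun u hu => Or.inl (hI u hu))
  · intro u v huv
    rcases closeUp_adj huv with h1 | h1
    · exact ⟨h1.fst_mem, h1.snd_mem, Or.inl (Or.inl h1)⟩
    · have := hA.left_mem
      have := hA.right_mem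
      exact ⟨by grind, by grind, Or.inr ⟨h1, t2'.mono hl' Set.subset_union_right le_rfl⟩⟩
  · rintro u rfl
    exact Or.inr (Or.inl ⟨rfl, v', Or.inr hv', Or.inr (hW' v' (by simp [hv'])), by grind,
      by grind, hvR'⟩)

/-- The case distinction for `RootedSP.tri_closeUp_terminal` in which the larger part of the series
composition is the first one. -/
lemma tri_closeUp_terminal_series (hA : RootedSP R A s r mA eA) (hB : RootedSP R B r t mB eB)
    (h : A.verts ∩ B.verts = {r})
    (ihA : 2 ≤ mA + eA → Tri (closeUp A s r) {s} (innerRoots R A s r) (innerRoots R A s r) ∧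
      Tri (closeUp A s r) {r} (innerRoots R A s r) (innerRoots R A s r))
    (hν : 2 ≤ mA + eA ∨ (1 ≤ mA + eA ∧ 1 ≤ mB + eB) ∨ (1 ≤ mA + eA ∧ r ∈ R)) :
    Tri (closeUp (A ⊔ B) s t) {s} (innerRoots R (A ⊔ B) s t) (innerRoots R (A ⊔ B) s t) ∧
    Tri (closeUp (A ⊔ B) s t) {t} (innerRoots R (A ⊔ B) s t) (innerRoots R (A ⊔ B) s t) := by
  rcases hν with h1 | ⟨h1, h2⟩ | ⟨h1, h2⟩
  · have hI : ∀ u ∈ innerRoots R A s r, u ∈ A.verts ∧ u ∈ innerRoots R (A ⊔ B) s t ∨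
        (u = r ∧ ∃ v ∈ B.verts, v ∈ innerRoots R (A ⊔ B) s t) :=
      fun u hu => Or.inl ⟨hu.1, innerRoots_series_left hB h hu⟩
    refine ⟨(ihA h1).1.series_closeUp hA hB h ?_ hI hI, (ihA h1).2.series_closeUp hA hB h ?_ hI hI⟩
    · rintro u rfl
      exact Or.inl ⟨hA.left_mem, rfl⟩
    · rintro u rfl
      exact Or.inr ⟨rfl, t, hB.right_mem, rfl⟩
  · have cA := hA.rootChain h1
    have cB := hB.rootChain h2
    exact ⟨tri_series_of_chains hA hB h cA cB (Or.inl rfl),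
      tri_series_of_chains hA hB h cA cB (Or.inr rfl)⟩
  · have cA := hA.rootChain h1
    exact ⟨tri_series_of_root hA hB h cA h2 (Or.inl rfl),
      tri_series_of_root hA hB h cA h2 (Or.inr rfl)⟩

/-- If `m + e ≥ 2`, then after closing up there is a cycle that is linked to any one of the
terminals and to two roots. -/
lemma RootedSP.tri_closeUp_terminal (h : RootedSP R W s t m e) (hν : 2 ≤ m + e) :
    Tri (closeUp W s t) {s} (innerRoots R W s t) (innerRoots R W s t) ∧
    Tri (closeUp W s t) {t} (innerRoots R W s t) (innerRoots R W s t) := by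
  induction h with
  | edge h => omega
  | @series A B s r t mA eA mB eB hA hB h ihA ihB =>
    have := hA.e_le_one
    have := hB.e_le_one
    by_cases hr : r ∈ R
    · have := rootInd_of_mem hr
      by_cases h1 : 1 ≤ mA + eA
      · exact tri_closeUp_terminal_series hA hB h ihA (by tauto)
      · rw [sup_comm, closeUp_comm, innerRoots_comm]
        rw [closeUp_comm, innerRoots_comm, and_comm] at ihB
        exact (tri_closeUp_terminal_series hB.symm hA.symm (by rwa [Set.inter_comm]) ihB
          (Or.inr (Or.inr ⟨by omega, hr⟩))).symm
    · have : rootInd R r = 0 := if_neg hr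
      by_cases h1 : 2 ≤ mA + eA ∨ (1 ≤ mA + eA ∧ 1 ≤ mB + eB)
      · exact tri_closeUp_terminal_series hA hB h ihA (by tauto)
      · rw [sup_comm, closeUp_comm, innerRoots_comm]
        rw [closeUp_comm, innerRoots_comm, and_comm] at ihB
        exact (tri_closeUp_terminal_series hB.symm hA.symm (by rwa [Set.inter_comm]) ihB
          (Or.inl (by omega))).symm
  | @parallel A B s t mA eA mB eB hA hB h hd ihA ihB =>
    have h' : B.verts ∩ A.verts = {s, t} := by rwa [Set.inter_comm]
    have hI : ∀ u ∈ innerRoots R A s t, u ∈ A.verts ∧ u ∈ innerRoots R (A ⊔ B) s t :=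
      fun u hu => ⟨hu.1, innerRoots_parallel_left hu⟩
    have hI' : ∀ u ∈ innerRoots R B s t, u ∈ B.verts ∧ u ∈ innerRoots R (A ⊔ B) s t :=
      fun u hu => ⟨hu.1, innerRoots_parallel_right hu⟩
    by_cases h1 : 2 ≤ mA + eA
    · refine ⟨((ihA h1).1.parallel hA hB h ?_ hI hI).mono (le_closeUp _ _ _),
        ((ihA h1).2.parallel hA hB h ?_ hI hI).mono (le_closeUp _ _ _)⟩
      · rintro u rfl; exact ⟨hA.left_mem, rfl⟩
      · rintro u rfl; exact ⟨hA.right_mem, rfl⟩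
    by_cases h2 : 2 ≤ mB + eB
    · rw [sup_comm] at hI' ⊢
      refine ⟨((ihB h2).1.parallel hB hA h' ?_ hI' hI').mono (le_closeUp _ _ _),
        ((ihB h2).2.parallel hB hA h' ?_ hI' hI').mono (le_closeUp _ _ _)⟩
      · rintro u rfl; exact ⟨hB.left_mem, rfl⟩
      · rintro u rfl; exact ⟨hB.right_mem, rfl⟩
    have cA := hA.rootChain (by omega)
    have cB := hB.rootChain (by omega)
    refine ⟨(tri_parallel_of_chains h cA cB).mono (le_closeUp _ _ _), ?_⟩
    have := tri_parallel_of_chains (by rwa [Set.pair_comm]) cA.symm cB.symm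
    rw [innerRoots_comm] at this
    exact this.mono (le_closeUp _ _ _)

/-- The case distinction for `RootedSP.tri_closeUp` in which the larger part of the series
composition is the first one. -/
lemma tri_closeUp_series (hA : RootedSP R A s r mA eA) (hB : RootedSP R B r t mB eB)
    (h : A.verts ∩ B.verts = {r})
    (ihA : 3 ≤ mA + eA →
      Tri (closeUp A s r) (innerRoots R A s r) (innerRoots R A s r) (innerRoots R A s r))
    (hν : 3 ≤ mA + eA ∨ (2 ≤ mA + eA ∧ (1 ≤ mB + eB ∨ r ∈ R))) :
    Tri (closeUp (A ⊔ B) s t) (innerRoots R (A ⊔ B) s t) (innerRoots R (A ⊔ B) s t)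
      (innerRoots R (A ⊔ B) s t) := by
  have hI : ∀ u ∈ innerRoots R A s r, u ∈ A.verts ∧ u ∈ innerRoots R (A ⊔ B) s t ∨
      (u = r ∧ ∃ v ∈ B.verts, v ∈ innerRoots R (A ⊔ B) s t) :=
    fun u hu => Or.inl ⟨hu.1, innerRoots_series_left hB h hu⟩
  rcases hν with h1 | ⟨h1, h2⟩
  · exact (ihA h1).series_closeUp hA hB h hI hI hI
  · refine (hA.tri_closeUp_terminal h1).2.series_closeUp hA hB h ?_ hI hI
    rintro u rfl
    refine Or.inr ⟨rfl, ?_⟩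
    rcases h2 with h2 | h2
    · obtain ⟨v, hv⟩ := (hB.rootChain h2).exists_innerRoot
      exact ⟨v, hv.1, innerRoots_series_right hA h hv⟩
    · exact ⟨u, hB.left_mem, mem_innerRoots_series hA hB h2⟩

/-- If `m + e ≥ 3`, then after closing up there is a cycle that is linked to three roots. -/
lemma RootedSP.tri_closeUp (h : RootedSP R W s t m e) (hν : 3 ≤ m + e) :
    Tri (closeUp W s t) (innerRoots R W s t) (innerRoots R W s t) (innerRoots R W s t) := by
  induction h with
  | edge h => omega
  | @series A B s r t mA eA mB eB hA hB h ihA ihB =>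
    have := hA.e_le_one
    have := hB.e_le_one
    by_cases h1 : 3 ≤ mA + eA ∨ (2 ≤ mA + eA ∧ (1 ≤ mB + eB ∨ r ∈ R))
    · exact tri_closeUp_series hA hB h ihA h1
    by_cases h2 : 3 ≤ mB + eB ∨ (2 ≤ mB + eB ∧ (1 ≤ mA + eA ∨ r ∈ R))
    · rw [sup_comm, closeUp_comm, innerRoots_comm]
      rw [closeUp_comm, innerRoots_comm] at ihB
      exact tri_closeUp_series hB.symm hA.symm (by rwa [Set.inter_comm]) ihB h2
    by_cases hr : r ∈ R
    · have := rootInd_of_mem hr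
      simp only [hr, or_true, and_true] at h1 h2
      exact tri_series_three_roots hA hB h (hA.rootChain (by omega)) (hB.rootChain (by omega)) hr
    · have : rootInd R r = 0 := if_neg hr
      omega
  | @parallel A B s t mA eA mB eB hA hB h hd ihA ihB =>
    have h' : B.verts ∩ A.verts = {s, t} := by rwa [Set.inter_comm]
    have hI : ∀ u ∈ innerRoots R A s t, u ∈ A.verts ∧ u ∈ innerRoots R (A ⊔ B) s t :=
      fun u hu => ⟨hu.1, innerRoots_parallel_left hu⟩
    have hI' : ∀ u ∈ innerRoots R B s t, u ∈ B.verts ∧ u ∈ innerRoots R (A ⊔ B) s t :=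
      fun u hu => ⟨hu.1, innerRoots_parallel_right hu⟩
    by_cases h1 : 3 ≤ mA + eA
    · exact ((ihA h1).parallel hA hB h hI hI hI).mono (le_closeUp _ _ _)
    by_cases h2 : 3 ≤ mB + eB
    · rw [sup_comm] at hI' ⊢
      exact ((ihB h2).parallel hB hA h' hI' hI' hI').mono (le_closeUp _ _ _)
    by_cases h3 : 2 ≤ mA + eA
    · exact ((hA.tri_closeUp_terminal h3).1.parallel_chain hA h
        (hB.rootChain (by omega))).mono (le_closeUp _ _ _)
    · rw [sup_comm]
      exact ((hB.tri_closeUp_terminal (by omega)).1.parallel_chain hB h'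
        (hA.rootChain (by omega))).mono (le_closeUp _ _ _)

/-- A token arises from a parallel composition, so it comes with a cycle in `W` itself, without
closing up, that is linked to both terminals and to a root. -/
lemma RootedSP.tri_terminals (h : RootedSP R W s t m e) (hm : 1 ≤ m) :
    Tri W.spanningCoe {s} {t} (innerRoots R W s t) := by
  induction h with
  | edge h => omega
  | @series A B s r t mA eA mB eB hA hB h ihA ihB =>
    have h' : B.verts ∩ A.verts = {r} := by rwa [Set.inter_comm]
    by_cases h1 : 1 ≤ mA
    · refine (ihA h1).series hA hB h ?_ ?_ fun u hu =>
        Or.inl ⟨hu.1, innerRoots_series_left hB h hu⟩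
      · rintro u rfl; exact Or.inl ⟨hA.left_mem, rfl⟩
      · rintro u rfl; exact Or.inr ⟨rfl, t, hB.right_mem, rfl⟩
    · have hI := innerRoots_series_right (t := t) hA h
      rw [sup_comm] at hI ⊢
      refine (ihB (by omega)).series hB.symm hA.symm h' ?_ ?_ fun u hu => Or.inl ⟨hu.1, hI hu⟩
      · rintro u rfl; exact Or.inr ⟨rfl, s, hA.left_mem, rfl⟩
      · rintro u rfl; exact Or.inl ⟨hB.right_mem, rfl⟩
  | @parallel A B s t mA eA mB eB hA hB h hd ihA ihB =>
    by_cases h1 : 1 ≤ mA + eA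
    · exact tri_parallel_of_chain hB h (hA.rootChain h1)
    · rw [sup_comm]
      exact tri_parallel_of_chain hA (by rwa [Set.inter_comm]) (hB.rootChain (by omega))

/-- The case of `RootedSP.tri_terminal` in which one part of a series composition has at least three
tokens. -/
lemma tri_terminal_series (hA : RootedSP R A s r mA eA) (hB : RootedSP R B r t mB eB)
    (h : A.verts ∩ B.verts = {r})
    (ihA : 3 ≤ mA → Tri A.spanningCoe {s} (innerRoots R A s r) (innerRoots R A s r) ∧
      Tri A.spanningCoe {r} (innerRoots R A s r) (innerRoots R A s r)) (hm : 3 ≤ mA) :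
    Tri (A ⊔ B).spanningCoe {s} (innerRoots R (A ⊔ B) s t) (innerRoots R (A ⊔ B) s t) ∧
    Tri (A ⊔ B).spanningCoe {t} (innerRoots R (A ⊔ B) s t) (innerRoots R (A ⊔ B) s t) := by
  have hI : ∀ u ∈ innerRoots R A s r, u ∈ A.verts ∧ u ∈ innerRoots R (A ⊔ B) s t ∨
      (u = r ∧ ∃ v ∈ B.verts, v ∈ innerRoots R (A ⊔ B) s t) :=
    fun u hu => Or.inl ⟨hu.1, innerRoots_series_left hB h hu⟩
  refine ⟨(ihA hm).1.series hA hB h ?_ hI hI, (ihA hm).2.series hA hB h ?_ hI hI⟩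
  · rintro u rfl; exact Or.inl ⟨hA.left_mem, rfl⟩
  · rintro u rfl; exact Or.inr ⟨rfl, t, hB.right_mem, rfl⟩

/-- In a series composition of two parts with a token each, there is a cycle that is linked to a
terminal and to two roots. -/
lemma tri_terminal_of_both (hA : RootedSP R A s r mA eA) (hB : RootedSP R B r t mB eB)
    (h : A.verts ∩ B.verts = {r}) (h1 : 1 ≤ mA) (h2 : 1 ≤ mB) :
    Tri (A ⊔ B).spanningCoe {s} (innerRoots R (A ⊔ B) s t) (innerRoots R (A ⊔ B) s t) := by
  obtain ⟨v, hv⟩ := (hB.rootChain (by omega)).exists_innerRoot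
  refine (hA.tri_terminals h1).series hA hB h ?_ ?_
    fun u hu => Or.inl ⟨hu.1, innerRoots_series_left hB h hu⟩
  · rintro u rfl; exact Or.inl ⟨hA.left_mem, rfl⟩
  · rintro u rfl; exact Or.inr ⟨rfl, v, hv.1, innerRoots_series_right hA h hv⟩

/-- If `m ≥ 3`, there is a cycle in `W` that is linked to any one of the terminals and to
two roots. In a parallel composition one of the parts has `m + e ≥ 2`, and the other closes
it up. -/
lemma RootedSP.tri_terminal (h : RootedSP R W s t m e) (hm : 3 ≤ m) :
    Tri W.spanningCoe {s} (innerRoots R W s t) (innerRoots R W s t) ∧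
    Tri W.spanningCoe {t} (innerRoots R W s t) (innerRoots R W s t) := by
  induction h with
  | edge h => omega
  | @series A B s r t mA eA mB eB hA hB h ihA ihB =>
    have h' : B.verts ∩ A.verts = {r} := by rwa [Set.inter_comm]
    by_cases h1 : 3 ≤ mA
    · exact tri_terminal_series hA hB h ihA h1
    by_cases h2 : 3 ≤ mB
    · rw [sup_comm, innerRoots_comm]
      rw [innerRoots_comm, and_comm] at ihB
      exact (tri_terminal_series hB.symm hA.symm h' ihB h2).symm
    refine ⟨tri_terminal_of_both hA hB h (by omega) (by omega), ?_⟩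
    rw [sup_comm, innerRoots_comm]
    exact tri_terminal_of_both hB.symm hA.symm h' (by omega) (by omega)
  | @parallel A B s t mA eA mB eB hA hB h hd ihA ihB =>
    have h' : B.verts ∩ A.verts = {s, t} := by rwa [Set.inter_comm]
    by_cases h1 : 2 ≤ mA + eA
    · have hI : ∀ u ∈ innerRoots R A s t, u ∈ A.verts ∧ u ∈ innerRoots R (A ⊔ B) s t :=
        fun u hu => ⟨hu.1, innerRoots_parallel_left hu⟩
      obtain ⟨ts, tt⟩ := hA.tri_closeUp_terminal h1
      refine ⟨ts.parallel hA hB h ?_ hI hI, tt.parallel hA hB h ?_ hI hI⟩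
      · rintro u rfl; exact ⟨hA.left_mem, rfl⟩
      · rintro u rfl; exact ⟨hA.right_mem, rfl⟩
    · have hI : ∀ u ∈ innerRoots R B s t, u ∈ B.verts ∧ u ∈ innerRoots R (A ⊔ B) s t :=
        fun u hu => ⟨hu.1, innerRoots_parallel_right hu⟩
      obtain ⟨ts, tt⟩ := hB.tri_closeUp_terminal (by omega)
      rw [sup_comm] at hI ⊢
      refine ⟨ts.parallel hB hA h' ?_ hI hI, tt.parallel hB hA h' ?_ hI hI⟩
      · rintro u rfl; exact ⟨hB.left_mem, rfl⟩
      · rintro u rfl; exact ⟨hB.right_mem, rfl⟩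

/-- The case distinction for `RootedSP.tri` in which the first part of the series composition has
the larger number of tokens. -/
lemma tri_series (hA : RootedSP R A s r mA eA) (hB : RootedSP R B r t mB eB)
    (h : A.verts ∩ B.verts = {r})
    (ihA : 5 ≤ mA →
      Tri A.spanningCoe (innerRoots R A s r) (innerRoots R A s r) (innerRoots R A s r))
    (hm : 5 ≤ mA ∨ (3 ≤ mA ∧ 1 ≤ mB)) :
    Tri (A ⊔ B).spanningCoe (innerRoots R (A ⊔ B) s t) (innerRoots R (A ⊔ B) s t)
      (innerRoots R (A ⊔ B) s t) := by
  have hI : ∀ u ∈ innerRoots R A s r, u ∈ A.verts ∧ u ∈ innerRoots R (A ⊔ B) s t ∨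
      (u = r ∧ ∃ v ∈ B.verts, v ∈ innerRoots R (A ⊔ B) s t) :=
    fun u hu => Or.inl ⟨hu.1, innerRoots_series_left hB h hu⟩
  rcases hm with h1 | ⟨h1, h2⟩
  · exact (ihA h1).series hA hB h hI hI hI
  · obtain ⟨v, hv⟩ := (hB.rootChain (by omega)).exists_innerRoot
    refine (hA.tri_terminal h1).2.series hA hB h ?_ hI hI
    rintro u rfl
    exact Or.inr ⟨rfl, v, hv.1, innerRoots_series_right hA h hv⟩

/-- If `m ≥ 5`, there is a cycle in `W` that is linked to three interior roots. In a parallel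
composition one of the parts has `m + e ≥ 3`, and the other closes it up. -/
lemma RootedSP.tri (h : RootedSP R W s t m e) (hm : 5 ≤ m) :
    Tri W.spanningCoe (innerRoots R W s t) (innerRoots R W s t) (innerRoots R W s t) := by
  induction h with
  | edge h => omega
  | @series A B s r t mA eA mB eB hA hB h ihA ihB =>
    by_cases h1 : 5 ≤ mA ∨ (3 ≤ mA ∧ 1 ≤ mB)
    · exact tri_series hA hB h ihA h1
    · rw [sup_comm, innerRoots_comm]
      rw [innerRoots_comm] at ihB
      exact tri_series hB.symm hA.symm (by rwa [Set.inter_comm]) ihB (by omega)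
  | @parallel A B s t mA eA mB eB hA hB h hd ihA ihB =>
    by_cases h1 : 3 ≤ mA + eA
    · have hI : ∀ u ∈ innerRoots R A s t, u ∈ A.verts ∧ u ∈ innerRoots R (A ⊔ B) s t :=
        fun u hu => ⟨hu.1, innerRoots_parallel_left hu⟩
      exact (hA.tri_closeUp h1).parallel hA hB h hI hI hI
    · have hI : ∀ u ∈ innerRoots R B s t, u ∈ B.verts ∧ u ∈ innerRoots R (A ⊔ B) s t :=
        fun u hu => ⟨hu.1, innerRoots_parallel_right hu⟩
      rw [sup_comm] at hI ⊢
      exact (hB.tri_closeUp (by omega)).parallel hB hA (by rwa [Set.inter_comm]) hI hI hI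

end

/-! ### Subdivisions of `K₄` from minors -/

section

variable {Γ : SimpleGraph V}

/-- A walk that ends in `S` can be cut at its first vertex in `S`. -/
lemma exists_walk_first_hit {S : Set V} {c a : V} (q : Γ.Walk c a) (ha : a ∈ S) :
    ∃ m ∈ S, ∃ q' : Γ.Walk c m, (∀ v ∈ q'.support, v ∈ q.support) ∧
      ∀ v ∈ q'.support, v ∈ S → v = m := by
  induction q with
  | nil => exact ⟨_, ha, .nil, by simp, by simp⟩
  | @cons c d a h q ih =>
    by_cases hc : c ∈ S
    · exact ⟨c, hc, .nil, by simp, by simp⟩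
    · obtain ⟨m, hm, q', h1, h2⟩ := ih ha
      refine ⟨m, hm, .cons h q', ?_, ?_⟩
      · simp only [SimpleGraph.Walk.support_cons, List.mem_cons]
        grind
      · simp only [SimpleGraph.Walk.support_cons, List.mem_cons]
        grind

/-- Any three vertices of a connected set are the leaves of a (possibly degenerate) subdivided
claw in that set. -/
lemma Conn.exists_claw {B : Set V} (hB : Conn Γ B) {a b c : V} (ha : a ∈ B) (hb : b ∈ B)
    (hc : c ∈ B) :
    ∃ m ∈ B, ∃ (p : Γ.Walk m a) (q : Γ.Walk m b) (r : Γ.Walk m c),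
      (p.IsPath ∧ q.IsPath ∧ r.IsPath) ∧
      (∀ v, v ∈ p.support ∨ v ∈ q.support ∨ v ∈ r.support → v ∈ B) ∧
      (∀ v ∈ p.support, v ∈ q.support → v = m) ∧ (∀ v ∈ p.support, v ∈ r.support → v = m) ∧
      ∀ v ∈ q.support, v ∈ r.support → v = m := by
  classical
  obtain ⟨P, hP⟩ := hB a ha b hb
  obtain ⟨Q, hQ⟩ := hB c hc a ha
  have hP' : ∀ v ∈ P.bypass.support, v ∈ B :=
    fun v hv => hP v (P.support_bypass_subset_support hv)
  have hp := P.bypass_isPath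
  generalize P.bypass = P at hP' hp
  obtain ⟨m, hm, q', h1, h2⟩ := exists_walk_first_hit (S := {v | v ∈ P.support}) Q (by simp)
  have hm' : m ∈ P.support := hm
  have h3 : ∀ v ∈ q'.bypass.support, v ∈ q'.support :=
    fun v hv => q'.support_bypass_subset_support hv
  have h4 : ∀ v ∈ (P.takeUntil m hm').support, v ∈ P.support :=
    fun v hv => P.support_takeUntil_subset_support hm' hv
  have h5 : ∀ v ∈ (P.dropUntil m hm').support, v ∈ P.support :=
    fun v hv => P.support_dropUntil_subset_support hm' hv
  have h2' : ∀ v ∈ q'.support, v ∈ P.support → v = m := h2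
  refine ⟨m, hP' m hm', (P.takeUntil m hm').reverse, P.dropUntil m hm', q'.bypass.reverse,
    ⟨(hp.takeUntil hm').reverse, hp.dropUntil hm', (q'.bypass_isPath).reverse⟩, ?_, ?_, ?_, ?_⟩
  · simp only [SimpleGraph.Walk.support_reverse, List.mem_reverse]
    grind
  · intro v hv hv'
    rw [SimpleGraph.Walk.support_reverse, List.mem_reverse] at hv
    have hpa : ((P.takeUntil m hm').append (P.dropUntil m hm')).IsPath := by
      rwa [SimpleGraph.Walk.take_spec]
    by_contra hne
    exact SimpleGraph.Walk.IsPath.ne_of_mem_support_of_append hpa hne hv hv' rfl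
  · simp only [SimpleGraph.Walk.support_reverse, List.mem_reverse]
    grind
  · simp only [SimpleGraph.Walk.support_reverse, List.mem_reverse]
    grind

/-- `Conn.exists_claw` with four indices, one of which is left out: the legs are given by sets
`T j` that meet only in the centre `m`. -/
lemma Conn.exists_claw_fin {B : Set V} (hB : Conn Γ B) (a : Fin 4 → V) (ha : ∀ j, a j ∈ B)
    (i : Fin 4) :
    ∃ m ∈ B, ∃ T : Fin 4 → Set V, (∀ j, T j ⊆ B) ∧
      (∀ j, j ≠ i → ∃ p : Γ.Walk m (a j), p.IsPath ∧ ∀ w ∈ p.support, w ∈ T j) ∧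
      ∀ j k, j ≠ i → k ≠ i → j ≠ k → ∀ w ∈ T j, w ∈ T k → w = m := by
  have hi : ∀ i : Fin 4, ∃ j k l : Fin 4, (j ≠ k ∧ j ≠ l ∧ k ≠ l) ∧
    ∀ n, n ≠ i → n = j ∨ n = k ∨ n = l := by decide
  obtain ⟨j, k, l, ⟨hjk, hjl, hkl⟩, hi⟩ := hi i
  obtain ⟨m, hm, p, q, r, ⟨hp, hq, hr⟩, hs, h1, h2, h3⟩ := hB.exists_claw (ha j) (ha k) (ha l)
  set T : Fin 4 → Set V := fun n => if n = j then {v | v ∈ p.support} else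
    if n = k then {v | v ∈ q.support} else {v | v ∈ r.support} with hT
  have hTj : T j = {v | v ∈ p.support} := by simp [hT]
  have hTk : T k = {v | v ∈ q.support} := by simp [hT, hjk.symm]
  have hTl : T l = {v | v ∈ r.support} := by simp [hT, hjl.symm, hkl.symm]
  refine ⟨m, hm, T, ?_, ?_, ?_⟩
  · intro n v hv
    simp only [hT] at hv
    split_ifs at hv
    · exact hs v (Or.inl hv)
    · exact hs v (Or.inr (Or.inl hv))
    · exact hs v (Or.inr (Or.inr hv))
  · intro n hn
    rcases hi n hn with rfl | rfl | rfl
    · exact ⟨p, hp, fun w hw => hTj ▸ hw⟩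
    · exact ⟨q, hq, fun w hw => hTk ▸ hw⟩
    · exact ⟨r, hr, fun w hw => hTl ▸ hw⟩
  · intro n n' hn hn' hnn w hw hw'
    rcases hi n hn with rfl | rfl | rfl <;> rcases hi n' hn' with rfl | rfl | rfl <;>
      simp only [hTj, hTk, hTl] at hw hw'
    · exact absurd rfl hnn
    · exact h1 w hw hw'
    · exact h2 w hw hw'
    · exact h1 w hw' hw
    · exact absurd rfl hnn
    · exact h3 w hw hw'
    · exact h2 w hw' hw
    · exact h3 w hw' hw
    · exact absurd rfl hnn

/-- A graph with a `K₄` minor, given by four pairwise touching connected sets, contains a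
subdivision of `K₄`: a claw in each of the sets connects the ends of the edges that leave it. -/
lemma exists_isK4Subdivision (hΓ : Γ ≤ G) (B : Fin 4 → Set V) (hB : ∀ i, Conn Γ (B i))
    (hd : ∀ i j, i ≠ j → ∀ v ∈ B i, v ∉ B j) (ht : ∀ i j, i ≠ j → Touch Γ (B i) (B j)) :
    ∃ K : G.Subgraph, IsK4Subdivision K ∧ K.edgeSet ⊆ Γ.edgeSet := by
  classical
  -- `a i j` is the end in `B i` of the chosen edge between `B i` and `B j`
  have hne : ∀ i, (B i).Nonempty := fun i => by
    obtain ⟨j, hj⟩ := exists_ne i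
    obtain ⟨a, ha, -⟩ := ht i j hj.symm
    exact ⟨a, ha⟩
  have hsel : ∀ i j : Fin 4, ∃ u v, i < j → u ∈ B i ∧ v ∈ B j ∧ Γ.Adj u v := by
    intro i j
    by_cases hij : i < j
    · obtain ⟨u, hu, v, hv, h⟩ := ht i j hij.ne
      exact ⟨u, v, fun _ => ⟨hu, hv, h⟩⟩
    · obtain ⟨u, hu⟩ := hne i
      exact ⟨u, u, fun h => absurd h hij⟩
  choose f g hfg using hsel
  choose d hdB using hne
  set a : Fin 4 → Fin 4 → V := fun i j => if i < j then f i j else if j < i then g j i else d i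
    with ha
  have haB : ∀ i j, a i j ∈ B i := by
    intro i j
    simp only [ha]
    split_ifs with h1 h2
    exacts [(hfg i j h1).1, (hfg j i h2).2.1, hdB i]
  have haAdj : ∀ i j, i < j → Γ.Adj (a i j) (a j i) := by
    intro i j hij
    simp only [ha, hij, if_true, not_lt_of_gt hij, if_false]
    exact (hfg i j hij).2.2
  choose b hbB T hTB hT hTT using fun i => (hB i).exists_claw_fin (a i) (haB i) i
  have hpath : ∀ i j, ∃ p : Γ.Walk (b i) (b j), i < j → p.IsPath ∧
      ∀ w ∈ p.support, w ∈ T i j ∨ w ∈ T j i := by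
    have hlt : ∀ i j, i < j → ∃ p : Γ.Walk (b i) (b j), p.IsPath ∧
        ∀ w ∈ p.support, w ∈ T i j ∨ w ∈ T j i := by
      intro i j hij
      obtain ⟨p, hp, hpT⟩ := hT i j hij.ne'
      obtain ⟨q, hq, hqT⟩ := hT j i hij.ne
      refine ⟨p.append (.cons (haAdj i j hij) q.reverse), ?_, ?_⟩
      · rw [SimpleGraph.Walk.isPath_def, SimpleGraph.Walk.support_append,
          SimpleGraph.Walk.support_cons, List.tail_cons, List.nodup_append,
          SimpleGraph.Walk.support_reverse, List.nodup_reverse]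
        refine ⟨hp.support_nodup, hq.support_nodup, ?_⟩
        rintro w hw w' hw' rfl
        rw [List.mem_reverse] at hw'
        exact hd i j hij.ne w (hTB i j (hpT w hw)) (hTB j i (hqT w hw'))
      · intro w hw
        rw [SimpleGraph.Walk.mem_support_append_iff, SimpleGraph.Walk.support_cons, List.mem_cons,
          SimpleGraph.Walk.support_reverse, List.mem_reverse] at hw
        rcases hw with hw | rfl | hw
        · exact Or.inl (hpT w hw)
        · exact Or.inl (hpT _ p.end_mem_support)
        · exact Or.inr (hqT w hw)
    intro i j
    rcases lt_trichotomy i j with h | rfl | h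
    · obtain ⟨p, hp⟩ := hlt i j h
      exact ⟨p, fun _ => hp⟩
    · exact ⟨.nil, fun h => absurd h (lt_irrefl _)⟩
    · obtain ⟨p, hp⟩ := hlt j i h
      exact ⟨p.reverse, fun h' => absurd h' (not_lt_of_gt h)⟩
  -- `P i j` follows a leg of the claw in `B i`, the edge, and a leg of the claw in `B j`
  choose P hP using hpath
  have hsame : ∀ i i' w, w ∈ B i → w ∈ B i' → i = i' := by
    intro i i' w hw hw'
    by_contra hne
    exact hd i i' hne w hw hw'
  -- the claw legs at one branch vertex meet only there
  have hmeet : ∀ i j i' j', i ≠ j → i' ≠ j' → (i, j) ≠ (i', j') → ∀ w ∈ T i j, w ∈ T i' j' →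
      w = b i ∧ i = i' := by
    intro i j i' j' hij hij' hne w hw hw'
    obtain rfl := hsame i i' w (hTB i j hw) (hTB i' j' hw')
    have hjj : j ≠ j' := fun h => hne (by rw [h])
    exact ⟨hTT i j j' hij.symm hij'.symm hjj w hw hw', rfl⟩
  refine ⟨_, ⟨b, fun i j => (P i j).mapLe hΓ, ?_, ?_, ?_, rfl⟩, ?_⟩
  · intro i j hij
    exact hsame i j (b i) (hbB i) (hij ▸ hbB j)
  · intro i j hij
    exact (SimpleGraph.Walk.isPath_mapLe hΓ).2 (hP i j hij).1
  · intro i j i' j' hij hij' hne w hw hw'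
    rw [SimpleGraph.Walk.support_mapLe_eq_support] at hw hw'
    have hne2 : (i, j) ≠ (j', i') := by
      rintro h
      obtain ⟨rfl, rfl⟩ := Prod.mk.inj h
      exact lt_asymm hij hij'
    have hne3 : (j, i) ≠ (i', j') := by
      rintro h
      obtain ⟨rfl, rfl⟩ := Prod.mk.inj h
      exact lt_asymm hij hij'
    have hne4 : (j, i) ≠ (j', i') := by
      rintro h
      obtain ⟨rfl, rfl⟩ := Prod.mk.inj h
      exact hne rfl
    rcases (hP i j hij).2 w hw with h1 | h1 <;> rcases (hP i' j' hij').2 w hw' with h2 | h2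
    · obtain ⟨rfl, rfl⟩ := hmeet _ _ _ _ hij.ne hij'.ne hne w h1 h2
      exact ⟨Or.inl rfl, Or.inl rfl⟩
    · obtain ⟨rfl, rfl⟩ := hmeet _ _ _ _ hij.ne hij'.ne' hne2 w h1 h2
      exact ⟨Or.inl rfl, Or.inr rfl⟩
    · obtain ⟨rfl, rfl⟩ := hmeet _ _ _ _ hij.ne' hij'.ne hne3 w h1 h2
      exact ⟨Or.inr rfl, Or.inl rfl⟩
    · obtain ⟨rfl, rfl⟩ := hmeet _ _ _ _ hij.ne' hij'.ne' hne4 w h1 h2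
      exact ⟨Or.inr rfl, Or.inr rfl⟩
  · intro e he
    simp only [SimpleGraph.Subgraph.edgeSet_iSup, Set.mem_iUnion,
      SimpleGraph.Walk.mem_edges_toSubgraph, SimpleGraph.Walk.edges_mapLe_eq_edges] at he
    obtain ⟨i, j, -, he⟩ := he
    exact (P i j).edges_subset_edgeSet he

end

/-! ### The supply of a part -/

/-- The edges of the paths `v y x` of length 2 in `G`, where `v` and `x` are fixed. -/
def linkEdges (G : SimpleGraph V) (x v : V) : Set (Sym2 V) :=
  {e | ∃ y, G.Adj v y ∧ G.Adj y x ∧ (e = s(v, y) ∨ e = s(y, x))}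

/-- The edges that a part `W` with terminals `s`, `t` supplies: its own edges, and those of the
paths of length 2 from its inner vertices to `x`. -/
def supply (x : V) (W : G.Subgraph) (s t : V) : Set (Sym2 V) :=
  W.edgeSet ∪ {e | ∃ v ∈ W.verts, v ≠ s ∧ v ≠ t ∧ e ∈ linkEdges G x v}

lemma exists_adj_of_mem_outerNbhd {x v : V} (h : v ∈ outerNbhd G (closedNbhd G x)) :
    v ∉ closedNbhd G x ∧ ∃ y, G.Adj v y ∧ G.Adj y x := by
  obtain ⟨h1, y, rfl | hy, h2⟩ := h
  · exact absurd (Or.inr h2.symm) h1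
  · exact ⟨h1, y, h2, SimpleGraph.Adj.symm hy⟩

/-- A triangle minor in `W` that is rooted at three vertices of `N(X)` gives a `K₄`-subdivision
with the help of the paths of length 2 to `x`. -/
lemma exists_isK4Subdivision_of_tri {x : V} {W : G.Subgraph} {s t : V}
    (hX : ∀ v ∈ W.verts, v ∉ closedNbhd G x)
    (hT : Tri W.spanningCoe (innerRoots (outerNbhd G (closedNbhd G x)) W s t)
      (innerRoots (outerNbhd G (closedNbhd G x)) W s t)
      (innerRoots (outerNbhd G (closedNbhd G x)) W s t)) :
    ∃ K : G.Subgraph, IsK4Subdivision K ∧ K.edgeSet ⊆ supply x W s t := by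
  set I := innerRoots (outerNbhd G (closedNbhd G x)) W s t with hI
  obtain ⟨B₁, B₂, B₃, ⟨c1, c2, c3⟩, ⟨m1, m2, m3⟩, ⟨d1, d2, d3⟩, t1, t2, t3⟩ := hT
  have hlink : ∀ v ∈ I, linkEdges G x v ⊆ supply x W s t :=
    fun v hv e he => Or.inr ⟨v, hv.1, hv.2.1, hv.2.2.1, he⟩
  set Γ : SimpleGraph V := SimpleGraph.fromEdgeSet (supply x W s t) with hΓdef
  have hadj : ∀ {u v}, u ≠ v → s(u, v) ∈ supply x W s t → Γ.Adj u v :=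
    fun h1 h2 => (SimpleGraph.fromEdgeSet_adj _).2 ⟨h2, h1⟩
  have hWΓ : W.spanningCoe ≤ Γ := fun u v (h : W.Adj u v) => hadj h.ne (Or.inl h)
  have hΓG : Γ ≤ G := by
    intro u v h
    rw [hΓdef, SimpleGraph.fromEdgeSet_adj] at h
    obtain ⟨h | ⟨w, -, -, -, y, h1, h2, h | h⟩, -⟩ := h
    · exact W.edgeSet_subset h
    · rw [← SimpleGraph.mem_edgeSet, h]; exact h1
    · rw [← SimpleGraph.mem_edgeSet, h]; exact h2
  -- the fourth branch set consists of `x` and the middle vertices of the paths of length 2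
  set X : Set V := {x} ∪ {y | ∃ v ∈ I, G.Adj v y ∧ G.Adj y x} with hXdef
  have hXX : ∀ y ∈ X, y ∈ closedNbhd G x := by
    rintro y (rfl | ⟨v, -, -, hy⟩)
    exacts [Or.inl rfl, Or.inr hy.symm]
  have hXconn : Conn Γ X := by
    have key : ∀ y ∈ X, ∃ p : Γ.Walk y x, ∀ w ∈ p.support, w ∈ X := by
      rintro y (rfl | ⟨v, hv, h1, h2⟩)
      · exact ⟨.nil, by simp [hXdef]⟩
      · have h3 : Γ.Adj y x := hadj h2.ne (hlink v hv ⟨y, h1, h2, Or.inr rfl⟩)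
        refine ⟨h3.toWalk, ?_⟩
        have : y ∈ X := Or.inr ⟨v, hv, h1, h2⟩
        have hx : x ∈ X := Or.inl rfl
        simp [this, hx]
    intro y hy y' hy'
    obtain ⟨p, hp⟩ := key y hy
    obtain ⟨q, hq⟩ := key y' hy'
    refine ⟨p.append q.reverse, fun w hw => ?_⟩
    rw [SimpleGraph.Walk.mem_support_append_iff, SimpleGraph.Walk.support_reverse,
      List.mem_reverse] at hw
    exact hw.elim (hp w) (hq w)
  have hXt : ∀ B : Set V, (∃ v ∈ B, v ∈ I) → Touch Γ B X := by
    rintro B ⟨v, hv, hvI⟩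
    obtain ⟨-, y, h1, h2⟩ := exists_adj_of_mem_outerNbhd hvI.2.2.2
    exact ⟨v, hv, y, Or.inr ⟨v, hvI, h1, h2⟩,
      hadj h1.ne (hlink v hvI ⟨y, h1, h2, Or.inl rfl⟩)⟩
  -- a connected set that touches another one in `W` lies in `W`
  have hBW : ∀ B B' : Set V, Conn W.spanningCoe B → Touch W.spanningCoe B B' →
      ∀ v ∈ B, v ∉ X := by
    rintro B B' hB ⟨a, ha, b, -, hab : W.Adj a b⟩ v hv hvX
    refine hX v ?_ (hXX v hvX)
    obtain ⟨p, -⟩ := hB v hv a ha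
    cases p with
    | nil => exact hab.fst_mem
    | cons h p => exact SimpleGraph.Subgraph.Adj.fst_mem (H := W) h
  have e1 := hBW B₁ B₂ c1 t1
  have e2 := hBW B₂ B₃ c2 t3
  have e3 := hBW B₃ B₁ c3 t2.symm
  have t1' := t1.mono hWΓ le_rfl le_rfl
  have t2' := t2.mono hWΓ le_rfl le_rfl
  have t3' := t3.mono hWΓ le_rfl le_rfl
  have t4 := hXt _ m1
  have t5 := hXt _ m2
  have t6 := hXt _ m3
  have h1 : ∀ i, Conn Γ ((![B₁, B₂, B₃, X] : Fin 4 → Set V) i) := by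
    intro i
    fin_cases i
    exacts [c1.mono hWΓ, c2.mono hWΓ, c3.mono hWΓ, hXconn]
  have h2 : ∀ i j, i ≠ j → ∀ v ∈ (![B₁, B₂, B₃, X] : Fin 4 → Set V) i,
      v ∉ (![B₁, B₂, B₃, X] : Fin 4 → Set V) j := by
    intro i j hij v hv hv'
    clear * - d1 d2 d3 e1 e2 e3 hij hv hv'
    fin_cases i <;> fin_cases j <;> simp at hij hv hv' <;> grind
  have h3 : ∀ i j, i ≠ j → Touch Γ ((![B₁, B₂, B₃, X] : Fin 4 → Set V) i)
      ((![B₁, B₂, B₃, X] : Fin 4 → Set V) j) := by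
    intro i j hij
    fin_cases i <;> fin_cases j <;>
      first | exact absurd rfl hij | assumption | (apply Touch.symm; assumption)
  obtain ⟨K, hK, hKe⟩ := exists_isK4Subdivision hΓG _ h1 h2 h3
  refine ⟨K, hK, hKe.trans ?_⟩
  rw [hΓdef, SimpleGraph.edgeSet_fromEdgeSet]
  exact Set.sdiff_subset

/-- The edge set `F` includes `k` edge-disjoint `K₄`-subdivisions of `G`. -/
def Packing (G : SimpleGraph V) (F : Set (Sym2 V)) (k : ℕ) : Prop :=
  ∃ K : Fin k → G.Subgraph, (∀ i, IsK4Subdivision (K i) ∧ (K i).edgeSet ⊆ F) ∧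
    ∀ i j, i ≠ j → Disjoint (K i).edgeSet (K j).edgeSet

namespace Packing

variable {F F' : Set (Sym2 V)} {k k' : ℕ}

lemma zero (F : Set (Sym2 V)) : Packing G F 0 :=
  ⟨fun i => i.elim0, fun i => i.elim0, fun i => i.elim0⟩

lemma one {K : G.Subgraph} (hK : IsK4Subdivision K) (hF : K.edgeSet ⊆ F) : Packing G F 1 :=
  ⟨fun _ => K, fun _ => ⟨hK, hF⟩, fun i j hij => absurd (Subsingleton.elim i j) hij⟩

lemma add (h : Packing G F k) (h' : Packing G F' k') (hd : Disjoint F F') :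
    Packing G (F ∪ F') (k + k') := by
  obtain ⟨K, hK, hKd⟩ := h
  obtain ⟨K', hK', hKd'⟩ := h'
  refine ⟨Fin.append K K', ?_, ?_⟩
  · intro i
    induction i using Fin.addCases with
    | left i =>
      rw [Fin.append_left]
      exact ⟨(hK i).1, (hK i).2.trans Set.subset_union_left⟩
    | right i =>
      rw [Fin.append_right]
      exact ⟨(hK' i).1, (hK' i).2.trans Set.subset_union_right⟩
  · intro i j hij
    induction i using Fin.addCases with
    | left i =>
      induction j using Fin.addCases with
      | left j =>
        rw [Fin.append_left, Fin.append_left]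
        exact hKd i j fun h => hij (by rw [h])
      | right j =>
        rw [Fin.append_left, Fin.append_right]
        exact hd.mono (hK i).2 (hK' j).2
    | right i =>
      induction j using Fin.addCases with
      | left j =>
        rw [Fin.append_left, Fin.append_right]
        exact (hd.mono (hK j).2 (hK' i).2).symm
      | right j =>
        rw [Fin.append_right, Fin.append_right]
        exact hKd' i j fun h => hij (by rw [h])

end Packing

/-- The set of roots: the vertices outside `X` with a neighbour in `X`, where `X` is the closed
neighbourhood of `x`. -/
abbrev rootSet (G : SimpleGraph V) (x : V) : Set V := outerNbhd G (closedNbhd G x)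

/-- Paths of length 2 to `x` from different vertices outside `X` share no edges, since their middle
vertices have degree 2. -/
lemma linkEdges_disjoint {x v w : V} (hdeg : ∀ y, G.Adj x y → (G.neighborSet y).encard = 2)
    (hv : v ∉ closedNbhd G x) (hw : w ∉ closedNbhd G x) (hvw : v ≠ w) :
    Disjoint (linkEdges G x v) (linkEdges G x w) := by
  rw [Set.disjoint_left]
  have hX : ∀ {y}, G.Adj y x → y ∈ closedNbhd G x := fun h => Or.inr h.symm
  have hx : x ∈ closedNbhd G x := Or.inl rfl
  rintro e ⟨y, h1, h2, he⟩ ⟨y', h1', h2', he'⟩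
  have hy := hX h2
  have hy' := hX h2'
  have hyy : y = y' := by
    rcases he with rfl | rfl <;> rcases he' with he' | he' <;>
      rw [Sym2.eq_iff] at he' <;> grind
  subst hyy
  -- otherwise the middle vertex would have the three neighbours `x`, `v`, `w`
  have hvx : v ≠ x := fun h => hv (h ▸ hx)
  have hwx : w ≠ x := fun h => hw (h ▸ hx)
  have h3 : ({x, v, w} : Set V) ⊆ G.neighborSet y := by
    rintro z (rfl | rfl | rfl)
    exacts [h2, h1.symm, h1'.symm]
  have h4 := Set.encard_le_encard h3
  rw [hdeg y h2.symm, Set.encard_insert_of_notMem (by simp [hvx.symm, hwx.symm]),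
    Set.encard_pair hvw] at h4
  exact absurd h4 (by decide)

lemma linkEdges_disjoint_edgeSet {x v : V} {W : G.Subgraph}
    (hX : ∀ v ∈ W.verts, v ∉ closedNbhd G x) : Disjoint (linkEdges G x v) W.edgeSet := by
  rw [Set.disjoint_left]
  rintro e ⟨y, h1, h2, rfl | rfl⟩ (he : W.Adj _ _)
  · exact hX _ he.snd_mem (Or.inr h2.symm)
  · exact hX _ he.fst_mem (Or.inr h2.symm)

section supply

variable {x s r t : V} {A B U W : G.Subgraph} {R : Set V} {m e mA eA mB eB : ℕ}

lemma supply_comm : supply x W s t = supply x W t s := by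
  ext e
  simp only [supply, Set.mem_union, Set.mem_ofPred_eq]
  grind

lemma supply_mono (h : U ≤ W) : supply x U s t ⊆ supply x W s t := by
  rintro e (he | ⟨v, hv, h'⟩)
  · exact Or.inl (SimpleGraph.Subgraph.edgeSet_mono h he)
  · exact Or.inr ⟨v, h.1 hv, h'⟩

lemma supply_series_subset :
    supply x (A ⊔ B) s t ⊆ supply x A s r ∪ supply x B r t ∪ linkEdges G x r := by
  rintro e (he | ⟨v, hv, hs, ht, he⟩)
  · rw [SimpleGraph.Subgraph.edgeSet_sup] at he
    exact Or.inl (he.imp Or.inl Or.inl)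
  · by_cases hr : v = r
    · subst hr; exact Or.inr he
    · exact Or.inl (hv.imp (fun h => Or.inr ⟨v, h, hs, hr, he⟩) fun h => Or.inr ⟨v, h, hr, ht, he⟩)

lemma supply_parallel_subset : supply x (A ⊔ B) s t ⊆ supply x A s t ∪ supply x B s t := by
  rintro e (he | ⟨v, hv, h⟩)
  · rw [SimpleGraph.Subgraph.edgeSet_sup] at he
    exact he.imp Or.inl Or.inl
  · exact hv.imp (fun hv => Or.inr ⟨v, hv, h⟩) fun hv => Or.inr ⟨v, hv, h⟩

lemma supply_subset_series_left (ht : t ∉ A.verts) :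
    supply x A s r ⊆ supply x (A ⊔ B) s t := by
  rintro e (he | ⟨v, hv, hs, -, he⟩)
  · exact Or.inl (SimpleGraph.Subgraph.edgeSet_mono le_sup_left he)
  · exact Or.inr ⟨v, Or.inl hv, hs, fun h => ht (h ▸ hv), he⟩

lemma supply_subset_series_right (hs : s ∉ B.verts) :
    supply x B r t ⊆ supply x (A ⊔ B) s t := by
  rintro e (he | ⟨v, hv, -, ht, he⟩)
  · exact Or.inl (SimpleGraph.Subgraph.edgeSet_mono le_sup_right he)
  · exact Or.inr ⟨v, Or.inr hv, fun h => hs (h ▸ hv), ht, he⟩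

lemma linkEdges_subset_supply (hr : r ∈ W.verts) (hs : r ≠ s) (ht : r ≠ t) :
    linkEdges G x r ⊆ supply x W s t :=
  fun _ he => Or.inr ⟨r, hr, hs, ht, he⟩

lemma linkEdges_disjoint_supply (hdeg : ∀ y, G.Adj x y → (G.neighborSet y).encard = 2)
    (hX : ∀ v ∈ W.verts, v ∉ closedNbhd G x) (hr : r ∉ closedNbhd G x)
    (hrW : r ∈ W.verts → r = s ∨ r = t) : Disjoint (linkEdges G x r) (supply x W s t) := by
  refine Set.disjoint_union_right.2 ⟨linkEdges_disjoint_edgeSet hX, ?_⟩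
  rw [Set.disjoint_right]
  rintro e ⟨v, hv, hs, ht, he⟩ he'
  refine Set.disjoint_left.1 (linkEdges_disjoint hdeg (hX v hv) hr ?_) he he'
  rintro rfl
  exact (hrW hv).elim hs ht

lemma supply_disjoint {s' t' : V} (hdeg : ∀ y, G.Adj x y → (G.neighborSet y).encard = 2)
    (hA : ∀ v ∈ A.verts, v ∉ closedNbhd G x) (hB : ∀ v ∈ B.verts, v ∉ closedNbhd G x)
    (hd : Disjoint A.edgeSet B.edgeSet)
    (h : ∀ v, v ∈ A.verts → v ∈ B.verts → v ≠ s → v ≠ t → v = s' ∨ v = t') :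
    Disjoint (supply x A s t) (supply x B s' t') := by
  refine Set.disjoint_union_left.2 ⟨Set.disjoint_union_right.2 ⟨hd, ?_⟩, ?_⟩
  · rw [Set.disjoint_right]
    rintro e ⟨v, -, -, -, he⟩
    exact Set.disjoint_left.1 (linkEdges_disjoint_edgeSet hA) he
  · rw [Set.disjoint_left]
    rintro e ⟨v, hv, hs, ht, he⟩
    exact Set.disjoint_left.1 (linkEdges_disjoint_supply hdeg hB (hA v hv)
      fun hvB => h v hv hvB hs ht) he

/-- Enough tokens in a part give a `K₄`-subdivision in its supply. -/
lemma RootedSP.packing_one (h : RootedSP (rootSet G x) W s t m e)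
    (hX : ∀ v ∈ W.verts, v ∉ closedNbhd G x) (hm : 5 ≤ m) :
    Packing G (supply x W s t) 1 := by
  obtain ⟨K, hK, hKe⟩ := exists_isK4Subdivision_of_tri hX (h.tri hm)
  exact .one hK hKe

end supply

/-! ### Packing subdivisions along the construction -/

/-- A stage of the packing process in which the part `W` still connects its terminals:
`k` edge-disjoint `K₄`-subdivisions have been found in the supply of `W`, and they avoid the supply
of a series-parallel subgraph `U` with the same terminals. Each `K₄`-subdivision pays for 26 tokens
of `W`, and the other tokens are still present in `U`, where at most 4 are left. The second
inequality does the same for tokens and flag together. -/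
def Live (x : V) (W : G.Subgraph) (s t : V) (m e k : ℕ) : Prop :=
  ∃ U m' e' F, RootedSP (rootSet G x) U s t m' e' ∧ U ≤ W ∧ m' ≤ 4 ∧
    m ≤ m' + 26 * k ∧ m + e ≤ m' + e' + 26 * k ∧
    Packing G F k ∧ F ⊆ supply x W s t ∧ Disjoint F (supply x U s t)

/-- A series-parallel subgraph of `W` with `n` tokens that hangs at the vertex `s` and has
its supply in `E`; nothing is required if `n = 0`. -/
def Tail (x : V) (W : G.Subgraph) (s : V) (n : ℕ) (E : Set (Sym2 V)) : Prop :=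
  n = 0 ∨ ∃ U a e, RootedSP (rootSet G x) U s a n e ∧ U ≤ W ∧ supply x U s a ⊆ E

/-- A stage of the packing process in which the `K₄`-subdivisions found in the supply of `W` may
separate the terminals: what is left are tails at the two terminals, with at most 4 tokens each.
The constant 17 is a credit that pays for what gets lost later; the worst loss occurs when two dead
parts are put in parallel, namely the 16 tokens of four tails, and the token that the composition
adds. -/
def Dead (x : V) (W : G.Subgraph) (s t : V) (m k : ℕ) : Prop :=
  ∃ n₁ n₂ E₁ E₂ F, Tail x W s n₁ E₁ ∧ Tail x W t n₂ E₂ ∧ n₁ ≤ 4 ∧ n₂ ≤ 4 ∧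
    m + 17 ≤ n₁ + n₂ + 26 * k ∧ Packing G F k ∧
    (F ⊆ supply x W s t ∧ E₁ ⊆ supply x W s t ∧ E₂ ⊆ supply x W s t) ∧
    Disjoint F E₁ ∧ Disjoint F E₂ ∧ Disjoint E₁ E₂

section stages

variable {x s r t : V} {A B U W : G.Subgraph} {R : Set V} {m e mA eA mB eB k k' n : ℕ}
  {E : Set (Sym2 V)}

lemma Live.symm (h : Live x W s t m e k) : Live x W t s m e k := by
  obtain ⟨U, m', e', F, hU, h1, h2, h3, h4, h5, h6, h7⟩ := h
  exact ⟨U, m', e', F, hU.symm, h1, h2, h3, h4, h5, supply_comm ▸ h6, supply_comm (W := U) ▸ h7⟩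

lemma Dead.symm (h : Dead x W s t m k) : Dead x W t s m k := by
  obtain ⟨n₁, n₂, E₁, E₂, F, h1, h2, h3, h4, h5, h6, h7, h8, h9, h10⟩ := h
  rw [supply_comm] at h7
  exact ⟨n₂, n₁, E₂, E₁, F, h2, h1, h4, h3, by omega, h6, ⟨h7.1, h7.2.2, h7.2.1⟩, h9, h8, h10.symm⟩

lemma Tail.mono (h : Tail x A s n E) (hA : A ≤ W) : Tail x W s n E :=
  h.imp_right fun ⟨U, a, e, h1, h2, h3⟩ => ⟨U, a, e, h1, h2.trans hA, h3⟩

lemma Tail.zero : Tail x W s 0 (∅ : Set (Sym2 V)) := Or.inl rfl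

/-- If at least 5 tokens have accumulated in `U`, then they are used up for a `K₄`-subdivision, and
the part dies. At most `4 + 4 + 1` tokens can have come together, so that the 26 tokens the
subdivision pays for also cover the credit `17 = 26 - 9` of the dead part. -/
lemma live_or_dead_of_part (hX : ∀ v ∈ W.verts, v ∉ closedNbhd G x) {m' e' : ℕ}
    {F : Set (Sym2 V)}
    (hU : RootedSP (rootSet G x) U s t m' e') (hUW : U ≤ W) (hm' : m' ≤ 9)
    (hm : m ≤ m' + 26 * k) (hme : m + e ≤ m' + e' + 26 * k) (hF : Packing G F k)
    (hFW : F ⊆ supply x W s t) (hd : Disjoint F (supply x U s t)) :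
    ∃ k, Live x W s t m e k ∨ Dead x W s t m k := by
  by_cases h : m' ≤ 4
  · exact ⟨k, Or.inl ⟨U, m', e', F, hU, hUW, h, hm, hme, hF, hFW, hd⟩⟩
  · refine ⟨k + 1, Or.inr ⟨0, 0, ∅, ∅, _, .zero, .zero, by omega, by omega, by omega,
      hF.add (hU.packing_one (fun v hv => hX v (hUW.1 hv)) (by omega)) hd,
      ⟨Set.union_subset hFW (supply_mono hUW), Set.empty_subset _, Set.empty_subset _⟩,
      Set.disjoint_empty _, Set.disjoint_empty _, Set.disjoint_empty _⟩⟩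

/-- If at least 5 tokens have accumulated in the tail at `s`, then they are used up for
a `K₄`-subdivision, and the tail is given up. -/
lemma dead_of_tails (hX : ∀ v ∈ W.verts, v ∉ closedNbhd G x) {n₁ n₂ : ℕ}
    {E₁ E₂ F : Set (Sym2 V)} (h₁ : Tail x W s n₁ E₁) (h₂ : Tail x W t n₂ E₂)
    (hn₁ : n₁ ≤ 8) (hn₂ : n₂ ≤ 4) (hm : m + 17 ≤ n₁ + n₂ + 26 * k) (hF : Packing G F k)
    (hFW : F ⊆ supply x W s t) (hE₁ : E₁ ⊆ supply x W s t) (hE₂ : E₂ ⊆ supply x W s t)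
    (d1 : Disjoint F E₁) (d2 : Disjoint F E₂) (d3 : Disjoint E₁ E₂) :
    ∃ k, Dead x W s t m k := by
  by_cases h : n₁ ≤ 4
  · exact ⟨k, n₁, n₂, E₁, E₂, F, h₁, h₂, h, hn₂, hm, hF, ⟨hFW, hE₁, hE₂⟩, d1, d2, d3⟩
  · obtain h0 | ⟨U, a, e, hU, hUW, hUE⟩ := h₁
    · omega
    refine ⟨k + 1, 0, n₂, ∅, E₂, F ∪ supply x U s a, .zero, h₂, by omega, hn₂, by omega,
      hF.add (hU.packing_one (fun v hv => hX v (hUW.1 hv)) (by omega)) (d1.mono_right hUE),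
      ⟨Set.union_subset hFW (hUE.trans hE₁), Set.empty_subset _, hE₂⟩,
      Set.disjoint_empty _, ?_, Set.empty_disjoint _⟩
    exact Set.disjoint_union_left.2 ⟨d2, d3.mono_left hUE⟩

end stages

section compositions

variable {x s r t : V} {A B : G.Subgraph} {m mA eA mB eB kA kB : ℕ}

/-- The supplies of two parts in series, and of their common vertex, are disjoint. -/
lemma supply_series (hdeg : ∀ y, G.Adj x y → (G.neighborSet y).encard = 2)
    (hX : ∀ v ∈ (A ⊔ B).verts, v ∉ closedNbhd G x)
    (hA : RootedSP (rootSet G x) A s r mA eA) (hB : RootedSP (rootSet G x) B r t mB eB)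
    (h : A.verts ∩ B.verts = {r}) :
    supply x A s r ⊆ supply x (A ⊔ B) s t ∧ supply x B r t ⊆ supply x (A ⊔ B) s t ∧
    Disjoint (supply x A s r) (supply x B r t) ∧
    Disjoint (linkEdges G x r) (supply x A s r) ∧ Disjoint (linkEdges G x r) (supply x B r t) := by
  have hXA : ∀ v ∈ A.verts, v ∉ closedNbhd G x := fun v hv => hX v (Or.inl hv)
  have hXB : ∀ v ∈ B.verts, v ∉ closedNbhd G x := fun v hv => hX v (Or.inr hv)
  have hAB : ∀ v, v ∈ A.verts → v ∈ B.verts → v = r := fun v h1 h2 => inter_subset_of_eq h h1 h2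
  refine ⟨supply_subset_series_left fun h' => hB.ne (hAB t h' hB.right_mem).symm,
    supply_subset_series_right fun h' => hA.ne (hAB s hA.left_mem h'), ?_, ?_, ?_⟩
  · exact supply_disjoint hdeg hXA hXB (edgeSet_disjoint_of_inter_singleton h)
      fun v h1 h2 _ h3 => absurd (hAB v h1 h2) h3
  · exact linkEdges_disjoint_supply hdeg hXA (hXA r hA.right_mem) fun _ => Or.inr rfl
  · exact linkEdges_disjoint_supply hdeg hXB (hXB r hB.left_mem) fun _ => Or.inl rfl

/-- Two live parts in series. -/
lemma live_series_live (hdeg : ∀ y, G.Adj x y → (G.neighborSet y).encard = 2)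
    (hX : ∀ v ∈ (A ⊔ B).verts, v ∉ closedNbhd G x)
    (hA : RootedSP (rootSet G x) A s r mA eA) (hB : RootedSP (rootSet G x) B r t mB eB)
    (h : A.verts ∩ B.verts = {r}) (lA : Live x A s r mA eA kA) (lB : Live x B r t mB eB kB) :
    ∃ k, Live x (A ⊔ B) s t (mA + mB) (max (max eA eB) (rootInd (rootSet G x) r)) k ∨
      Dead x (A ⊔ B) s t (mA + mB) k := by
  have hAB : ∀ v, v ∈ A.verts → v ∈ B.verts → v = r := fun v h1 h2 => inter_subset_of_eq h h1 h2
  obtain ⟨sA, sB, hdAB, hrA, hrB⟩ := supply_series hdeg hX hA hB h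
  obtain ⟨U, m₁, e₁, F, hU, hUA, a1, a2, a3, a4, a5, a6⟩ := lA
  obtain ⟨U', m₂, e₂, F', hU', hUB, b1, b2, b3, b4, b5, b6⟩ := lB
  have hUU : U.verts ∩ U'.verts = {r} := by
    refine Set.Subset.antisymm (fun v hv => hAB v (hUA.1 hv.1) (hUB.1 hv.2)) ?_
    rintro v rfl
    exact ⟨hU.right_mem, hU'.left_mem⟩
  have := hA.e_le_one
  have := hB.e_le_one
  refine live_or_dead_of_part hX (hU.series hU' hUU) (sup_le_sup hUA hUB) (by omega)
    (k := kA + kB) (by omega) (by omega) (a4.add b4 (hdAB.mono a5 b5))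
    (Set.union_subset (a5.trans sA) (b5.trans sB)) ?_
  refine Disjoint.mono_right (supply_series_subset (r := r)) ?_
  simp only [Set.disjoint_union_left, Set.disjoint_union_right]
  exact ⟨⟨⟨a6, hdAB.symm.mono b5 (supply_mono hUA)⟩, hdAB.mono a5 (supply_mono hUB), b6⟩,
    (hrA.mono_right a5).symm, (hrB.mono_right b5).symm⟩

/-- A live part and a dead part in series: the live part prolongs the tail of the dead one. -/
lemma live_series_dead (hdeg : ∀ y, G.Adj x y → (G.neighborSet y).encard = 2)
    (hX : ∀ v ∈ (A ⊔ B).verts, v ∉ closedNbhd G x)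
    (hA : RootedSP (rootSet G x) A s r mA eA) (hB : RootedSP (rootSet G x) B r t mB eB)
    (h : A.verts ∩ B.verts = {r}) (lA : Live x A s r mA eA kA) (dB : Dead x B r t mB kB) :
    ∃ k, Dead x (A ⊔ B) s t (mA + mB) k := by
  have hAB : ∀ v, v ∈ A.verts → v ∈ B.verts → v = r := fun v h1 h2 => inter_subset_of_eq h h1 h2
  obtain ⟨sA, sB, hdAB, hrA, hrB⟩ := supply_series hdeg hX hA hB h
  obtain ⟨U, m₁, e₁, F, hU, hUA, a1, a2, a3, a4, a5, a6⟩ := lA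
  obtain ⟨n₁, n₂, E₁, E₂, F', h₁, h₂, hn₁, hn₂, hm, hF', ⟨i1, i2, i3⟩, d1, d2, d3⟩ := dB
  have hUs := supply_mono (x := x) (s := s) (t := r) hUA
  have tail : Tail x (A ⊔ B) s (m₁ + n₁) (supply x U s r ∪ E₁ ∪ linkEdges G x r) := by
    right
    obtain rfl | ⟨L, a, e, hL, hLB, hLE⟩ := h₁
    · exact ⟨U, r, e₁, hU, hUA.trans le_sup_left, fun _ h => Or.inl (Or.inl h)⟩
    · refine ⟨U ⊔ L, a, _, hU.series hL ?_, sup_le_sup hUA hLB,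
        (supply_series_subset (r := r)).trans ?_⟩
      · refine Set.Subset.antisymm (fun v hv => hAB v (hUA.1 hv.1) (hLB.1 hv.2)) ?_
        rintro v rfl
        exact ⟨hU.right_mem, hL.left_mem⟩
      · exact Set.union_subset_union_left _ (Set.union_subset_union_right _ hLE)
  refine dead_of_tails hX (k := kA + kB) tail (h₂.mono le_sup_right) (by omega) hn₂ (by omega)
    (a4.add hF' (hdAB.mono a5 i1)) (Set.union_subset (a5.trans sA) (i1.trans sB))
    (Set.union_subset (Set.union_subset (hUs.trans sA) (i2.trans sB)) ?_) (i3.trans sB) ?_ ?_ ?_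
  · exact linkEdges_subset_supply (Or.inl hA.right_mem) hA.ne.symm hB.ne
  · simp only [Set.disjoint_union_left, Set.disjoint_union_right]
    exact ⟨⟨⟨a6, hdAB.symm.mono i1 hUs⟩, hdAB.mono a5 i2, d1⟩,
      (hrA.mono_right a5).symm, (hrB.mono_right i1).symm⟩
  · exact Set.disjoint_union_left.2 ⟨hdAB.mono a5 i3, d2⟩
  · simp only [Set.disjoint_union_left]
    exact ⟨⟨hdAB.mono hUs i3, d3⟩, hrB.mono_right i3⟩

/-- Two dead parts in series: the two tails at the common vertex are given up. -/
lemma dead_series_dead (hdeg : ∀ y, G.Adj x y → (G.neighborSet y).encard = 2)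
    (hX : ∀ v ∈ (A ⊔ B).verts, v ∉ closedNbhd G x)
    (hA : RootedSP (rootSet G x) A s r mA eA) (hB : RootedSP (rootSet G x) B r t mB eB)
    (h : A.verts ∩ B.verts = {r}) (dA : Dead x A s r mA kA) (dB : Dead x B r t mB kB) :
    ∃ k, Dead x (A ⊔ B) s t (mA + mB) k := by
  obtain ⟨sA, sB, hdAB, -, -⟩ := supply_series hdeg hX hA hB h
  obtain ⟨n₁, n₂, E₁, E₂, F, h₁, -, hn₁, hn₂, hm, hF, ⟨i1, i2, -⟩, d1, -, -⟩ := dA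
  obtain ⟨n₁', n₂', E₁', E₂', F', -, h₂, hn₁', hn₂', hm', hF', ⟨j1, -, j2⟩, -, d2, -⟩ := dB
  refine ⟨kA + kB, n₁, n₂', E₁, E₂', F ∪ F', h₁.mono le_sup_left, h₂.mono le_sup_right, hn₁, hn₂',
    by omega, hF.add hF' (hdAB.mono i1 j1),
    ⟨Set.union_subset (i1.trans sA) (j1.trans sB), i2.trans sA, j2.trans sB⟩, ?_, ?_, ?_⟩
  · exact Set.disjoint_union_left.2 ⟨d1, hdAB.symm.mono j1 i2⟩
  · exact Set.disjoint_union_left.2 ⟨hdAB.mono i1 j2, d2⟩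
  · exact hdAB.mono i2 j2

/-- The supplies of parallel parts are disjoint. -/
lemma supply_disjoint_parallel (hdeg : ∀ y, G.Adj x y → (G.neighborSet y).encard = 2)
    (hX : ∀ v ∈ (A ⊔ B).verts, v ∉ closedNbhd G x)
    (h : A.verts ∩ B.verts = {s, t}) (hd : Disjoint A.edgeSet B.edgeSet) :
    Disjoint (supply x A s t) (supply x B s t) :=
  supply_disjoint hdeg (fun v hv => hX v (Or.inl hv)) (fun v hv => hX v (Or.inr hv)) hd
    fun _ h1 h2 _ _ => inter_subset_of_eq h h1 h2

/-- Two live parts in parallel. -/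
lemma live_parallel_live (hdeg : ∀ y, G.Adj x y → (G.neighborSet y).encard = 2)
    (hX : ∀ v ∈ (A ⊔ B).verts, v ∉ closedNbhd G x)
    (hA : RootedSP (rootSet G x) A s t mA eA) (hB : RootedSP (rootSet G x) B s t mB eB)
    (h : A.verts ∩ B.verts = {s, t}) (hd : Disjoint A.edgeSet B.edgeSet)
    (lA : Live x A s t mA eA kA) (lB : Live x B s t mB eB kB) :
    ∃ k, Live x (A ⊔ B) s t (mA + mB + max eA eB) (min eA eB) k ∨
      Dead x (A ⊔ B) s t (mA + mB + max eA eB) k := by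
  have hdAB := supply_disjoint_parallel hdeg hX h hd
  obtain ⟨U, m₁, e₁, F, hU, hUA, a1, a2, a3, a4, a5, a6⟩ := lA
  obtain ⟨U', m₂, e₂, F', hU', hUB, b1, b2, b3, b4, b5, b6⟩ := lB
  have hUU : U.verts ∩ U'.verts = {s, t} := by
    refine Set.Subset.antisymm (fun v hv => inter_subset_of_eq h (hUA.1 hv.1) (hUB.1 hv.2)) ?_
    rintro v (rfl | rfl)
    exacts [⟨hU.left_mem, hU'.left_mem⟩, ⟨hU.right_mem, hU'.right_mem⟩]
  have := hA.e_le_one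
  have := hB.e_le_one
  have := hU.e_le_one
  have := hU'.e_le_one
  refine live_or_dead_of_part hX (hU.parallel hU' hUU (hd.mono
    (SimpleGraph.Subgraph.edgeSet_mono hUA) (SimpleGraph.Subgraph.edgeSet_mono hUB)))
    (sup_le_sup hUA hUB) (by omega)
    (k := kA + kB) (by omega) (by omega) (a4.add b4 (hdAB.mono a5 b5))
    (Set.union_subset (a5.trans (supply_mono le_sup_left)) (b5.trans (supply_mono le_sup_right))) ?_
  refine Disjoint.mono_right supply_parallel_subset ?_
  simp only [Set.disjoint_union_left, Set.disjoint_union_right]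
  exact ⟨⟨a6, hdAB.symm.mono b5 (supply_mono hUA)⟩, hdAB.mono a5 (supply_mono hUB), b6⟩

/-- A live part in parallel with a dead part keeps the terminals connected; the tails of the dead
part are given up. -/
lemma live_parallel_dead (hdeg : ∀ y, G.Adj x y → (G.neighborSet y).encard = 2)
    (hX : ∀ v ∈ (A ⊔ B).verts, v ∉ closedNbhd G x)
    (hA : RootedSP (rootSet G x) A s t mA eA) (hB : RootedSP (rootSet G x) B s t mB eB)
    (h : A.verts ∩ B.verts = {s, t}) (hd : Disjoint A.edgeSet B.edgeSet)
    (lA : Live x A s t mA eA kA) (dB : Dead x B s t mB kB) :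
    Live x (A ⊔ B) s t (mA + mB + max eA eB) (min eA eB) (kA + kB) := by
  have hdAB := supply_disjoint_parallel hdeg hX h hd
  obtain ⟨U, m₁, e₁, F, hU, hUA, a1, a2, a3, a4, a5, a6⟩ := lA
  obtain ⟨n₁, n₂, E₁, E₂, F', -, -, hn₁, hn₂, hm, hF', ⟨i1, -, -⟩, -⟩ := dB
  have := hA.e_le_one
  have := hB.e_le_one
  refine ⟨U, m₁, e₁, F ∪ F', hU, hUA.trans le_sup_left, a1, by omega, by omega,
    a4.add hF' (hdAB.mono a5 i1),
    Set.union_subset (a5.trans (supply_mono le_sup_left)) (i1.trans (supply_mono le_sup_right)), ?_⟩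
  exact Set.disjoint_union_left.2 ⟨a6, hdAB.symm.mono i1 (supply_mono hUA)⟩

/-- Two dead parts in parallel: all tails are given up. -/
lemma dead_parallel_dead (hdeg : ∀ y, G.Adj x y → (G.neighborSet y).encard = 2)
    (hX : ∀ v ∈ (A ⊔ B).verts, v ∉ closedNbhd G x)
    (h : A.verts ∩ B.verts = {s, t}) (hd : Disjoint A.edgeSet B.edgeSet)
    (dA : Dead x A s t mA kA) (dB : Dead x B s t mB kB) (hm : m ≤ mA + mB + 1) :
    Dead x (A ⊔ B) s t m (kA + kB) := by
  have hdAB := supply_disjoint_parallel hdeg hX h hd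
  obtain ⟨n₁, n₂, E₁, E₂, F, -, -, hn₁, hn₂, hm₁, hF, ⟨i1, -, -⟩, -⟩ := dA
  obtain ⟨n₁', n₂', E₁', E₂', F', -, -, hn₁', hn₂', hm₂, hF', ⟨j1, -, -⟩, -⟩ := dB
  exact ⟨0, 0, ∅, ∅, F ∪ F', .zero, .zero, by omega, by omega, by omega,
    hF.add hF' (hdAB.mono i1 j1),
    ⟨Set.union_subset (i1.trans (supply_mono le_sup_left)) (j1.trans (supply_mono le_sup_right)),
      Set.empty_subset _, Set.empty_subset _⟩,
    Set.disjoint_empty _, Set.disjoint_empty _, Set.disjoint_empty _⟩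

end compositions

/-- Every rooted series-parallel graph that avoids `X` has a live or a dead stage. -/
lemma RootedSP.live_or_dead {x s t : V} {W : G.Subgraph} {m e : ℕ}
    (hdeg : ∀ y, G.Adj x y → (G.neighborSet y).encard = 2)
    (h : RootedSP (rootSet G x) W s t m e) (hX : ∀ v ∈ W.verts, v ∉ closedNbhd G x) :
    ∃ k, Live x W s t m e k ∨ Dead x W s t m k := by
  induction h with
  | @edge s t h =>
    exact ⟨0, Or.inl ⟨_, 0, 0, ∅, .edge h, le_rfl, by omega, by omega, by omega, .zero _,
      Set.empty_subset _, Set.empty_disjoint _⟩⟩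
  | @series A B s r t mA eA mB eB hA hB h ihA ihB =>
    obtain ⟨kA, lA | dA⟩ := ihA fun v hv => hX v (Or.inl hv)
    · obtain ⟨kB, lB | dB⟩ := ihB fun v hv => hX v (Or.inr hv)
      · exact live_series_live hdeg hX hA hB h lA lB
      · exact (live_series_dead hdeg hX hA hB h lA dB).imp fun _ => Or.inr
    · obtain ⟨kB, lB | dB⟩ := ihB fun v hv => hX v (Or.inr hv)
      · rw [sup_comm] at hX ⊢
        obtain ⟨k, hk⟩ := live_series_dead hdeg hX hB.symm hA.symm (by rwa [Set.inter_comm])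
          lB.symm dA.symm
        rw [add_comm mB] at hk
        exact ⟨k, Or.inr hk.symm⟩
      · exact (dead_series_dead hdeg hX hA hB h dA dB).imp fun _ => Or.inr
  | @parallel A B s t mA eA mB eB hA hB h hd ihA ihB =>
    have := hA.e_le_one
    have := hB.e_le_one
    obtain ⟨kA, lA | dA⟩ := ihA fun v hv => hX v (Or.inl hv)
    · obtain ⟨kB, lB | dB⟩ := ihB fun v hv => hX v (Or.inr hv)
      · exact live_parallel_live hdeg hX hA hB h hd lA lB
      · exact ⟨_, Or.inl (live_parallel_dead hdeg hX hA hB h hd lA dB)⟩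
    · obtain ⟨kB, lB | dB⟩ := ihB fun v hv => hX v (Or.inr hv)
      · rw [sup_comm] at hX ⊢
        have := live_parallel_dead hdeg hX hB hA (by rwa [Set.inter_comm]) hd.symm lB dA
        rw [add_comm mB, max_comm, min_comm] at this
        exact ⟨_, Or.inl this⟩
      · exact ⟨_, Or.inr (dead_parallel_dead hdeg hX h hd dA dB (by omega))⟩

/-- The supply of a series-parallel graph includes edge-disjoint `K₄`-subdivisions in number
proportional to the tokens. -/
lemma RootedSP.exists_packing {x s t : V} {W : G.Subgraph} {m e : ℕ}
    (hdeg : ∀ y, G.Adj x y → (G.neighborSet y).encard = 2)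
    (h : RootedSP (rootSet G x) W s t m e) (hX : ∀ v ∈ W.verts, v ∉ closedNbhd G x) :
    ∃ k, Packing G (supply x W s t) k ∧ m + e ≤ 26 * k + 5 := by
  have := h.e_le_one
  obtain ⟨k, ⟨U, m', e', F, hU, -, h1, -, h2, hF, hFW, -⟩ |
    ⟨n₁, n₂, E₁, E₂, F, -, -, h1, h2, h3, hF, ⟨hFW, -⟩, -⟩⟩ := h.live_or_dead hdeg hX
  · have := hU.e_le_one
    obtain ⟨K, hK, hKd⟩ := hF
    exact ⟨k, ⟨K, fun i => ⟨(hK i).1, (hK i).2.trans hFW⟩, hKd⟩, by omega⟩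
  · obtain ⟨K, hK, hKd⟩ := hF
    exact ⟨k, ⟨K, fun i => ⟨(hK i).1, (hK i).2.trans hFW⟩, hKd⟩, by omega⟩

/-! ### Ear decompositions -/

lemma earUnion_cons (F : Ear G) (L : List (Ear G)) :
    earUnion (F :: L) = F.toSubgraph ⊔ earUnion L := by
  simp only [earUnion, List.mem_cons, iSup_or, iSup_sup_eq, iSup_iSup_eq_left]

lemma le_earUnion {F : Ear G} {L : List (Ear G)} (h : F ∈ L) : F.toSubgraph ≤ earUnion L :=
  le_iSup₂_of_le (f := fun (F : Ear G) (_ : F ∈ L) => F.toSubgraph) F h le_rfl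

lemma EarSeq.of_get {U : G.Subgraph} {L : List (Ear G)}
    (h : ∀ j : Fin L.length, (L.get j).IsPathOn (U ⊔ earUnion (L.take j))) : EarSeq U L := by
  induction L generalizing U with
  | nil => trivial
  | cons F L ih =>
    have h0 := h ⟨0, by simp⟩
    refine ⟨by simpa [earUnion] using h0, ih fun j => ?_⟩
    have hj := h j.succ
    simpa only [List.get_eq_getElem, Fin.val_succ, List.getElem_cons_succ, List.take_succ_cons,
      earUnion_cons, sup_assoc] using hj

/-- The shape of an ear decomposition: an `s`-`t` path, followed by an ear sequence. -/
lemma IsEarDecomposition.exists_cons {W : G.Subgraph} {s t : V} {L : List (Ear G)}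
    (h : IsEarDecomposition W s t L) :
    ∃ E L', L = E :: L' ∧ E.ends = {s, t} ∧ EarSeq E.toSubgraph L' := by
  obtain ⟨⟨E, hE, hst⟩, -, h3⟩ := h
  cases L with
  | nil => simp at hE
  | cons E' L' =>
    obtain rfl : E' = E := by simpa using hE
    refine ⟨E', L', rfl, ?_, .of_get fun j => ?_⟩
    · rw [Sym2.eq_iff] at hst
      rwa [Ear.ends, Set.pair_eq_pair_iff]
    · have hj := h3 j.succ (Nat.succ_pos _)
      simpa only [List.get_eq_getElem, Fin.val_succ, List.getElem_cons_succ, List.take_succ_cons,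
        earUnion_cons] using hj

/-- Every vertex of an ear sequence that is not in the initial graph is an interior vertex of the
first ear that contains it. -/
lemma EarSeq.exists_mem_interior {U : G.Subgraph} {L : List (Ear G)} (h : EarSeq U L) {v : V}
    (hv : v ∈ (earUnion L).verts) (hU : v ∉ U.verts) : ∃ F ∈ L, v ∈ F.interior := by
  induction L generalizing U with
  | nil => simp [earUnion] at hv
  | cons F L ih =>
    by_cases hF : v ∈ F.toSubgraph.verts
    · refine ⟨F, List.mem_cons_self, hF, fun hv' => hU ?_⟩
      rw [← h.1.1] at hv'
      exact hv'.2
    · rw [earUnion_cons] at hv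
      obtain ⟨F', hF', h'⟩ := ih h.2 (hv.resolve_left hF) (not_or.2 ⟨hU, hF⟩)
      exact ⟨F', List.mem_cons_of_mem _ hF', h'⟩

lemma Ear.bar_le_barUnion (x : V) {F : Ear G} {L : List (Ear G)} (h : F ∈ L) :
    F.bar x ≤ barUnion x L :=
  le_iSup₂_of_le (f := fun (F : Ear G) (_ : F ∈ L) => F.bar x) F h le_rfl

lemma linkEdges_subset_bar {x v : V} {F : Ear G} (hv : v ∈ F.interior) :
    linkEdges G x v ⊆ (F.bar x).edgeSet := by
  rintro e ⟨y, h1, h2, he⟩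
  have hle : G.subgraphOfAdj h1 ⊔ G.subgraphOfAdj h2 ≤ F.bar x :=
    le_sup_of_le_right <| le_iSup_of_le v <| le_iSup_of_le y <| le_iSup_of_le hv <|
      le_iSup_of_le h1 <| le_iSup_of_le h2 le_rfl
  refine SimpleGraph.Subgraph.edgeSet_mono hle ?_
  rw [SimpleGraph.Subgraph.edgeSet_sup]
  exact he.imp (fun h => by simp [h]) fun h => by simp [h]

/-- All vertices of `W` but the terminals are interior vertices of ears, so the graphs `F̄` include
everything that `W` supplies. -/
lemma IsEarDecomposition.supply_subset {x : V} {W : G.Subgraph} {s t : V} {L : List (Ear G)}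
    (h : IsEarDecomposition W s t L) : supply x W s t ⊆ (barUnion x L).edgeSet := by
  obtain ⟨E, L', rfl, hE, hseq⟩ := h.exists_cons
  have hW := h.2.1
  rintro e (he | ⟨v, hv, hs, ht, he⟩)
  · have hle : W ≤ barUnion x (E :: L') := by
      rw [← hW]
      exact iSup₂_le fun F hF => le_sup_left.trans (Ear.bar_le_barUnion x hF)
    exact SimpleGraph.Subgraph.edgeSet_mono hle he
  · have hF : ∃ F ∈ E :: L', v ∈ F.interior := by
      by_cases hvE : v ∈ E.toSubgraph.verts
      · refine ⟨E, List.mem_cons_self, hvE, ?_⟩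
        rw [hE]
        exact not_or.2 ⟨hs, ht⟩
      · rw [← hW, earUnion_cons] at hv
        obtain ⟨F, hF, h'⟩ := hseq.exists_mem_interior (hv.resolve_left hvE) hvE
        exact ⟨F, List.mem_cons_of_mem _ hF, h'⟩
    obtain ⟨F, hF, hvF⟩ := hF
    exact SimpleGraph.Subgraph.edgeSet_mono (Ear.bar_le_barUnion x hF)
      (linkEdges_subset_bar hvF he)

lemma IsK4Subdivision.le_of_edgeSet_subset {K U : G.Subgraph} (hK : IsK4Subdivision K)
    (h : K.edgeSet ⊆ U.edgeSet) : K ≤ U := by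
  obtain ⟨b, P, hb, -, -, rfl⟩ := hK
  refine iSup_le fun i => iSup_le fun j => iSup_le fun hij => ?_
  have hnil : ¬ (P i j).Nil := fun h' => hij.ne (hb h'.eq)
  rw [SimpleGraph.Walk.toSubgraph_le_iff hnil]
  have hle : (P i j).toSubgraph ≤ ⨆ (i : Fin 4) (j : Fin 4) (_ : i < j), (P i j).toSubgraph :=
    le_iSup_of_le i <| le_iSup_of_le j <| le_iSup_of_le hij le_rfl
  refine Set.Subset.trans ?_ h
  rw [← SimpleGraph.Walk.toSubgraph_le_iff hnil]
  exact hle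

lemma HasEdgeDisjointK4s.mono {U U' : G.Subgraph} {k k' : ℕ} (h : HasEdgeDisjointK4s U k)
    (hU : U ≤ U') (hk : k' ≤ k) : HasEdgeDisjointK4s U' k' := by
  obtain ⟨K, hK, hd⟩ := h
  exact ⟨fun i => K (Fin.castLE hk i), fun i => ⟨(hK _).1, (hK _).2.trans hU⟩,
    fun i j hij => hd _ _ fun h' => hij (Fin.castLE_injective hk h')⟩

lemma ContainsK4.hasEdgeDisjointK4s {U : G.Subgraph} (h : ContainsK4 U) :
    HasEdgeDisjointK4s U 1 := by
  obtain ⟨K, hK⟩ := h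
  exact ⟨fun _ => K, fun _ => hK, fun i j hij => absurd (Subsingleton.elim i j) hij⟩

lemma ContainsK4.mono {U U' : G.Subgraph} (h : ContainsK4 U) (hU : U ≤ U') : ContainsK4 U' :=
  h.imp fun _ hK => ⟨hK.1, hK.2.trans hU⟩

/-- The ears of any ear decomposition of a series-parallel graph that avoids `X`, together with
the paths to `x`, contain about one edge-disjoint `K₄`-subdivision for every 26 `x`-ears. -/
lemma exists_hasEdgeDisjointK4s_barUnion {x : V} {W : G.Subgraph} {s t : V} {L : List (Ear G)}
    (hdeg : ∀ y, G.Adj x y → (G.neighborSet y).encard = 2) (hW : IsSeriesParallel W s t)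
    (hX : ∀ v ∈ W.verts, v ∉ closedNbhd G x) (hL : IsEarDecomposition W s t L) :
    ∃ k, HasEdgeDisjointK4s (barUnion x L) k ∧ numXEars x L ≤ 26 * k + 5 := by
  have hsub := hL.supply_subset (x := x)
  have hU := hL.2.1
  obtain ⟨E, L', rfl, hE, hseq⟩ := hL.exists_cons
  obtain ⟨q, hq, hqE⟩ := Ear.exists_walk hE
  have hEW : ∀ F ∈ E :: L', F.toSubgraph ≤ W := fun F hF => hU ▸ le_earUnion hF
  have hst : s ≠ t := by
    rintro rfl
    have h1 : E.fst ∈ E.ends := Or.inl rfl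
    have h2 : E.snd ∈ E.ends := Or.inr rfl
    rw [hE] at h1 h2
    refine E.ne ?_
    simp_all
  obtain ⟨h, -⟩ | ⟨-, m, e, h⟩ := hW.rootedSP (rootSet G x)
  · exact absurd h hst
  obtain ⟨k, ⟨K, hK, hd⟩, hk⟩ := h.exists_packing hdeg hX
  refine ⟨k, ⟨K, fun i => ⟨(hK i).1, (hK i).1.le_of_edgeSet_subset ((hK i).2.trans hsub)⟩, hd⟩, ?_⟩
  have hc := (h.countBound q hq (hqE ▸ hEW E List.mem_cons_self) L' (hqE ▸ hseq)
    fun F hF => hEW F (List.mem_cons_of_mem _ hF)).2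
  rw [hqE, ← hE, ← rootedCount_cons] at hc
  exact (show numXEars x (E :: L') ≤ m + e from hc).trans hk

/-- Part (b) for an arbitrary ear decomposition of `H - X`. -/
lemma hasEdgeDisjointK4s_of_isEarDecomposition {x : V} {H : G.Subgraph} {s t : V}
    {L : List (Ear G)} (hdeg : ∀ y, G.Adj x y → (G.neighborSet y).encard = 2) (hH : ContainsK4 H)
    (hW : IsSeriesParallel (H.deleteVerts (closedNbhd G x)) s t)
    (hL : IsEarDecomposition (H.deleteVerts (closedNbhd G x)) s t L) :
    HasEdgeDisjointK4s (H ⊔ barUnion x L) (numXEars x L / 200 + 1) ∧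
      (200 ≤ numXEars x L ∨ ContainsK4 (barUnion x L) →
        HasEdgeDisjointK4s (barUnion x L) (numXEars x L / 200 + 1)) := by
  obtain ⟨k, hk, hle⟩ := exists_hasEdgeDisjointK4s_barUnion hdeg hW (fun v hv => hv.2) hL
  by_cases h : 200 ≤ numXEars x L
  -- `k` is at least `(λ - 5) / 26`, which exceeds `λ / 200` as soon as `λ ≥ 200`
  · have := hk.mono le_rfl (k' := numXEars x L / 200 + 1) (by omega)
    exact ⟨this.mono le_sup_right le_rfl, fun _ => this⟩
  · rw [Nat.div_eq_of_lt (not_le.1 h)]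
    exact ⟨(hH.mono le_sup_left).hasEdgeDisjointK4s,
      fun h' => (h'.resolve_left h).hasEdgeDisjointK4s⟩

/-- By the maximality of good NEDs, the supremum that defines the `x`-ear number is attained,
unless it is the junk value `0` for the lack of good NEDs. -/
lemma exists_isGoodNED_of_xEarNumber_pos {x : V} {H : G.Subgraph} {s t : V}
    (h : 0 < xEarNumber x H s t) :
    ∃ L, IsGoodNED x H s t L ∧ numXEars x L = xEarNumber x H s t := by
  set S := {n | ∃ L, IsGoodNED x H s t L ∧ numXEars x L = n} with hS
  have hne : S.Nonempty := by
    rw [Set.nonempty_iff_ne_empty]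
    intro h0
    rw [xEarNumber, ← hS, h0, csSup_empty] at h
    exact lt_irrefl _ h
  refine Nat.sSup_mem hne ?_
  obtain ⟨n, L, hL, rfl⟩ := hne
  refine ⟨numXEars x L, ?_⟩
  rintro _ ⟨L', hL', rfl⟩
  exact hL.2.1 L' hL'.1

end NestedEar

theorem lemma5p1 {V : Type*} [Finite V] (G : SimpleGraph V) (x : V)
    (hG : NestedEar.Standing G x) :
    -- many `x`-ears in `G` yield many edge-disjoint subdivisions in `G`
    (∀ (k : ℕ) (s t : V),
      NestedEar.IsSeriesParallel
        ((⊤ : G.Subgraph).deleteVerts (NestedEar.closedNbhd G x)) s t →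
      200 * k ≤ NestedEar.xEarNumber x (⊤ : G.Subgraph) s t →
      NestedEar.HasEdgeDisjointK4s (⊤ : G.Subgraph) k) ∧
    -- the general version, for good NEDs of subgraphs `H`
    (∀ (H : G.Subgraph) (s t : V) (L : List (NestedEar.Ear G)),
      NestedEar.ContainsK4 H →
      NestedEar.IsSeriesParallel (H.deleteVerts (NestedEar.closedNbhd G x)) s t →
      NestedEar.IsGoodNED x H s t L →
      NestedEar.HasEdgeDisjointK4s (H ⊔ NestedEar.barUnion x L)
        (NestedEar.numXEars x L / 200 + 1) ∧
      (200 ≤ NestedEar.numXEars x L ∨ NestedEar.ContainsK4 (NestedEar.barUnion x L) →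
        NestedEar.HasEdgeDisjointK4s (NestedEar.barUnion x L)
          (NestedEar.numXEars x L / 200 + 1))) := by
  refine ⟨fun k s t hSP hk => ?_, fun H s t L hH hSP hL =>
    NestedEar.hasEdgeDisjointK4s_of_isEarDecomposition hG.degree_two hH hSP hL.1.1⟩
  rcases Nat.eq_zero_or_pos k with rfl | hpos
  · exact ⟨fun i => i.elim0, fun i => i.elim0, fun i => i.elim0⟩
  · obtain ⟨L, hL, hLn⟩ := NestedEar.exists_isGoodNED_of_xEarNumber_pos
      (lt_of_lt_of_le (by omega) hk)
    have := (NestedEar.hasEdgeDisjointK4s_of_isEarDecomposition hG.degree_two hG.contains_K4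
      hSP hL.1.1).1
    exact this.mono le_top (by omega)
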